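/- Let $E$ be a real vector space of dimension $n\ge 1$ with norm $\|x\|^2=\langle Bx,x\rangle$, where $B:E\to E^*$ is linear, symmetric and positive definite, and let $\|s\|_*^2=\langle s,B^{-1}s\rangle$ on $E^*$. Let $\nu\in[0,1]$ and $L>0$. Let $f:E\to\mathbb R$ be bounded below, with $f^*=\inf f$, and differentiable with $\|\nabla f(y)-\nabla f(x)\|_*\le L\|y-x\|^\nu$ for all $x,y\in E$. For $\mu>0$ put $$f_\mu(x)=\frac1\kappa\int_E f(x+\mu u)e^{-\|u\|^2/2}\,du,\qquad \kappa=\int_E e^{-\|u\|^2/2}\,du .$$ Let $\tilde f:E\to\mathbb R$ be a (measurable) inexact oracle with noise level $\delta>0$: $|f(x)-\tilde f(x)|\le\delta$ for all $x\in E$. From $x_0\in E$ consider the process $$x_{k+1}=x_k-h\,B^{-1}g_\mu(x_k,u_k),\qquad g_\mu(x,u)=\frac{\tilde f(x+\mu u)-\tilde f(x)}{\mu}\,Bu,$$ where $u_0,u_1,\dots$ are independent standard Gaussian vectors in $E$ (density $\kappa^{-1}e^{-\|u\|^2/2}$), and $$h=\frac{D}{80(n+4)A_1},\qquad A_1=\frac{L}{\mu^{1-\nu}}n^{\frac{1+\nu}2},\qquad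 D=\mu^{1-\nu}.$$ **Theorem.** Fix $\nu\in[0,1]$, $L>0$, $\Delta\ge0$ and $\bar\varepsilon>0$; all constants hidden in $O$ and $\Theta$ below are positive and depend on these four numbers only. For every $n\ge1$ and $\varepsilon\in(0,\bar\varepsilon]$ there is $\mu\in(0,1)$, depending only on $n$, $\varepsilon$ and the four fixed numbers, such that for all $E$ and $f$ as above the function $f_\mu$ is well defined and differentiable, and, for all $x\in E$, $$|f_\mu(x)-f(x)|\le\frac{L}{1+\nu}\mu^{1+\nu}n^{\frac{1+\nu}2}=\Theta\!\left(\frac{\varepsilon}{n^{\frac{1+\nu}2}}\right),$$ and such that, for all $x_0$ with $f(x_0)-f^*\le\Delta$ and all $\tilde f$ as above with $$\delta<\frac{\mu^{\frac{5-\nu}2}}{n^{\frac{3-\nu}4}}=O\!\left(\frac{\varepsilon^{\frac{5-\nu}{2(1+\nu)}}}{n^{\frac{13-3\nu}4}}\right),$$ the expectations below are finite and $$\min_{0\le k\le N-1}\mathbb E\,\|\nabla f_\mu(x_k)\|_*^2\le\varepsilon\qquad\text{after}\qquad N=O\!\left(\frac{n^{\frac{7-3\nu}2}}{\varepsilon^{\frac{3-\nu}{1+\nu}}}\right)$$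 steps; more precisely, there is a constant $c$, depending on the four fixed numbers only, such that this holds for every integer $N\ge c\,n^{\frac{7-3\nu}2}/\varepsilon^{\frac{3-\nu}{1+\nu}}$. -/

import Mathlib

open MeasureTheory ProbabilityTheory

universe u v

noncomputable section

/-! The `n`-dimensional space `E` with a positive definite operator `B : E → E*` and the norm
`‖x‖² = ⟨Bx, x⟩` is a finite-dimensional real inner product space `E`: its inner product is
`⟨Bx, y⟩`, so `B` is the Riesz isomorphism `InnerProductSpace.toDual ℝ E`, and the norm of
`StrongDual ℝ E` is the dual norm, `‖s‖² = ⟨s, B⁻¹ s⟩`. Gradients are elements of the dual space,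
that is, Fréchet derivatives. -/

namespace ZerothOrder

section Definitions

variable {E : Type*} [NormedAddCommGroup E] [InnerProductSpace ℝ E] [FiniteDimensional ℝ E]
  [MeasurableSpace E] [BorelSpace E]

/-- `f` is differentiable, and its gradient is `ν`-Hölder continuous with constant `L` with respect
to the norm of `E` and the dual norm. -/
def HasHolderGradient (f : E → ℝ) (ν L : ℝ) : Prop :=
  Differentiable ℝ f ∧ ∀ x y : E, ‖fderiv ℝ f y - fderiv ℝ f x‖ ≤ L * ‖y - x‖ ^ ν

/-- `ft` is an inexact zeroth-order oracle for `f` with noise level `δ > 0`. The noise is arbitrary,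
up to measurability, so it may be biased and discontinuous. -/
def IsInexactOracle (f ft : E → ℝ) (δ : ℝ) : Prop :=
  0 < δ ∧ Measurable ft ∧ ∀ x : E, |f x - ft x| ≤ δ

/-- The normalizing constant `κ = ∫ exp (-‖u‖² / 2) du`. -/
def gaussNorm (E : Type*) [NormedAddCommGroup E] [InnerProductSpace ℝ E] [FiniteDimensional ℝ E]
    [MeasurableSpace E] [BorelSpace E] : ℝ :=
  ∫ u : E, Real.exp (-(1 / 2) * ‖u‖ ^ 2)

/-- The Gaussian approximation `f_μ (x) = κ⁻¹ ∫ f (x + μ u) exp (-‖u‖² / 2) du`. -/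
def smoothed (f : E → ℝ) (μ : ℝ) (x : E) : ℝ :=
  (gaussNorm E)⁻¹ * ∫ u : E, f (x + μ • u) * Real.exp (-(1 / 2) * ‖u‖ ^ 2)

/-- The random gradient estimation `g_μ (x, u) = ((ft (x + μ u) - ft x) / μ) B u`. -/
def gradEst (ft : E → ℝ) (μ : ℝ) (x u : E) : StrongDual ℝ E :=
  ((ft (x + μ • u) - ft x) / μ) • InnerProductSpace.toDual ℝ E u

/-- The iterates `x_{k+1} = x_k - h_k B⁻¹ g_μ (x_k, u_k)` from `x₀`, for step sizes `h` and a
sequence of directions `u`. -/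
def iterate (ft : E → ℝ) (μ : ℝ) (h : ℕ → ℝ) (x₀ : E) (u : ℕ → E) : ℕ → E
  | 0 => x₀
  | k + 1 => iterate ft μ h x₀ u k -
      h k • (InnerProductSpace.toDual ℝ E).symm (gradEst ft μ (iterate ft μ h x₀ u k) (u k))

end Definitions

/-- The Lipschitz constant `A₁ = L n^((1+ν)/2) / μ^(1-ν)` of the gradient of `f_μ`. -/
def smoothConst (ν L : ℝ) (n : ℕ) (μ : ℝ) : ℝ :=
  L * (n : ℝ) ^ ((1 + ν) / 2) / μ ^ (1 - ν)

/-- The step size `h = D / (80 (n + 4) A₁)` with step parameter `D = μ^(1-ν)`. -/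
def stepSize (ν L : ℝ) (n : ℕ) (μ : ℝ) : ℝ :=
  μ ^ (1 - ν) / (80 * ((n : ℝ) + 4) * smoothConst ν L n μ)

/-- The bound `ε_f = L / (1+ν) μ^(1+ν) n^((1+ν)/2)` for the functional gap `|f_μ - f|`. -/
def gapBound (ν L : ℝ) (n : ℕ) (μ : ℝ) : ℝ :=
  L / (1 + ν) * μ ^ (1 + ν) * (n : ℝ) ^ ((1 + ν) / 2)

/-- The strict upper bound `μ^((5-ν)/2) / n^((3-ν)/4)` for the noise level. -/
def noiseBound (ν : ℝ) (n : ℕ) (μ : ℝ) : ℝ :=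
  μ ^ ((5 - ν) / 2) / (n : ℝ) ^ ((3 - ν) / 4)

end ZerothOrder

end

/-!
Differentiating the Gaussian density rather than `f` (Cameron–Martin) shows that `f_μ` is
differentiable for every `f` of exponential growth. Applied to `∇f` in place of `f`, it writes the
derivative of `∇f_μ` as the mean of `μ⁻¹ (∇f(x + μ u) - ∇f(x)) ⊗ u`, so `∇f_μ` is Lipschitz with
constant `A₁`.

By Stein's identity the noiseless estimator `g_μ(x, u)` has mean `∇f_μ(x)`. Noise changes the
difference quotient by at most `2 δ / μ`, which Young's inequality turns into the correlation bound
`𝔼 ⟨∇f_μ, g_μ⟩ ≥ (3/4) ‖∇f_μ‖² - 4 (δ/μ)²`, and Gaussian moments bound `𝔼 ‖g_μ‖²`. The descent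
inequality for the `A₁`-smooth function `f_μ` then shows that a step decreases `𝔼 f_μ` by a multiple
of `h 𝔼 ‖∇f_μ‖²`, up to an error of order `h (μ n)^(1+ν)`. With `(μ n)^(1+ν)` a small multiple of
`ε` this error is a fraction of `h ε`. Since `f_μ` decreases by at most `Δ + L` in total, some
iterate has `𝔼 ‖∇f_μ‖² ≤ ε` once `N h ε / 4 ≥ Δ + L`.
-/

noncomputable section

open Filter
open scoped RealInnerProductSpace

namespace ZerothOrder

section GaussianMeasure

variable {E : Type*} [NormedAddCommGroup E] [InnerProductSpace ℝ E] [FiniteDimensional ℝ E]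
  [MeasurableSpace E] [BorelSpace E] {G : Type*} [NormedAddCommGroup G] [NormedSpace ℝ G]

lemma gaussNorm_pos : 0 < gaussNorm E := by
  rw [gaussNorm, GaussianFourier.integral_rexp_neg_mul_sq_norm (by norm_num)]
  positivity

lemma ofReal_gaussNorm :
    ((gaussNorm E : ℝ) : ℂ) = (Real.pi / ((1 / 2 : ℝ) : ℂ)) ^ (Module.finrank ℝ E / 2 : ℂ) := by
  rw [gaussNorm, ← GaussianFourier.integral_cexp_neg_mul_sq_norm (by simp),
    ← integral_complex_ofReal]
  push_cast
  rfl

/-- The density of the standard Gaussian measure with respect to Lebesgue measure. -/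
def gaussDensity (u : E) : ℝ := (gaussNorm E)⁻¹ * Real.exp (-(1 / 2) * ‖u‖ ^ 2)

lemma gaussDensity_nonneg (u : E) : 0 ≤ gaussDensity u :=
  mul_nonneg (inv_nonneg.2 gaussNorm_pos.le) (Real.exp_pos _).le

lemma measurable_gaussDensity : Measurable (gaussDensity : E → ℝ) := by
  unfold gaussDensity
  fun_prop

lemma integrable_gaussDensity : Integrable (gaussDensity : E → ℝ) :=
  (Integrable.of_integral_ne_zero gaussNorm_pos.ne').const_mul _

lemma integral_cexp_inner_mul_gaussDensity (t : E) :
    ∫ u : E, gaussDensity u • Complex.exp (⟪u, t⟫ * Complex.I) =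
      Complex.exp (-(‖t‖ : ℂ) ^ 2 / 2) := by
  have fourier := GaussianFourier.integral_cexp_neg_mul_sq_norm_add (V := E)
    (b := ((1 / 2 : ℝ) : ℂ)) (by simp) Complex.I t
  rw [← ofReal_gaussNorm] at fourier
  calc ∫ u : E, gaussDensity u • Complex.exp (⟪u, t⟫ * Complex.I)
      = ((gaussNorm E : ℝ) : ℂ)⁻¹ *
          ∫ u : E, Complex.exp (-((1 / 2 : ℝ) : ℂ) * ‖u‖ ^ 2 + Complex.I * ⟪t, u⟫) := by
        rw [← integral_const_mul]
        congr 1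
        ext u
        rw [gaussDensity, Complex.real_smul, Complex.exp_add, real_inner_comm]
        push_cast
        ring_nf
    _ = Complex.exp (Complex.I ^ 2 * ‖t‖ ^ 2 / (4 * ((1 / 2 : ℝ) : ℂ))) := by
        rw [fourier, inv_mul_cancel_left₀ (by exact_mod_cast gaussNorm_pos.ne')]
    _ = Complex.exp (-(‖t‖ : ℂ) ^ 2 / 2) := by
        rw [Complex.I_sq]
        push_cast
        ring_nf

lemma stdGaussian_eq_withDensity :
    stdGaussian E = volume.withDensity (fun u => ENNReal.ofReal (gaussDensity u)) := by
  have : IsFiniteMeasure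
      ((volume : Measure E).withDensity (fun u => ENNReal.ofReal (gaussDensity u))) :=
    isFiniteMeasure_withDensity_ofReal integrable_gaussDensity.2
  refine Measure.ext_of_charFun (funext fun t => ?_)
  rw [charFun_stdGaussian, ← integral_cexp_inner_mul_gaussDensity, charFun_apply,
    integral_withDensity_eq_integral_toReal_smul measurable_gaussDensity.ennreal_ofReal (by simp)]
  simp_rw [ENNReal.toReal_ofReal (gaussDensity_nonneg _)]

lemma integral_stdGaussian (g : E → G) :
    ∫ u, g u ∂(stdGaussian E) = ∫ u, gaussDensity u • g u := by
  rw [stdGaussian_eq_withDensity,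
    integral_withDensity_eq_integral_toReal_smul measurable_gaussDensity.ennreal_ofReal (by simp)]
  simp_rw [ENNReal.toReal_ofReal (gaussDensity_nonneg _)]

lemma integrable_stdGaussian_iff {g : E → G} :
    Integrable g (stdGaussian E) ↔ Integrable (fun u => Real.exp (-(1 / 2) * ‖u‖ ^ 2) • g u) := by
  rw [stdGaussian_eq_withDensity, integrable_withDensity_iff_integrable_smul'
    measurable_gaussDensity.ennreal_ofReal (by simp)]
  simp_rw [ENNReal.toReal_ofReal (gaussDensity_nonneg _), gaussDensity, mul_smul]
  exact integrable_fun_smul_iff (inv_ne_zero gaussNorm_pos.ne') _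

/-- The Cameron–Martin formula. -/
lemma integral_add_stdGaussian (g : E → G) (y : E) :
    ∫ u, g (u + y) ∂(stdGaussian E) =
      ∫ u, Real.exp (⟪u, y⟫ - ‖y‖ ^ 2 / 2) • g u ∂(stdGaussian E) := by
  rw [integral_stdGaussian, integral_stdGaussian,
    ← integral_sub_right_eq_self (fun u => gaussDensity u • g (u + y)) y]
  congr 1
  ext u
  rw [sub_add_cancel, smul_smul, gaussDensity, gaussDensity, mul_assoc, ← Real.exp_add,
    norm_sub_sq_real]
  ring_nf

lemma integrable_exp_mul_norm_stdGaussian (a : ℝ) :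
    Integrable (fun u => Real.exp (a * ‖u‖)) (stdGaussian E) := by
  obtain ⟨C, hC, hint⟩ := IsGaussian.exists_integrable_exp_sq (stdGaussian E)
  refine (hint.const_mul (Real.exp (a ^ 2 / (4 * C)))).mono'
    (by fun_prop) (Eventually.of_forall fun u => ?_)
  rw [Real.norm_of_nonneg (Real.exp_pos _).le, ← Real.exp_add, Real.exp_le_exp, ← sub_nonneg]
  calc 0 ≤ (a - 2 * C * ‖u‖) ^ 2 / (4 * C) := by positivity
    _ = a ^ 2 / (4 * C) + C * ‖u‖ ^ 2 - a * ‖u‖ := by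
        field_simp
        ring

lemma smoothed_eq_integral (F : E → ℝ) (μ : ℝ) (x : E) :
    smoothed F μ x = ∫ u, F (x + μ • u) ∂(stdGaussian E) := by
  rw [smoothed, integral_stdGaussian, ← integral_const_mul]
  simp only [gaussDensity, smul_eq_mul, mul_assoc, mul_comm (F _)]

end GaussianMeasure

section ExpGrowth

/-- `F` grows at most exponentially in the norm. Such functions are integrable against Gaussian
measures, together with their products and their compositions with affine maps. -/
def ExpGrowth {E G : Type*} [NormedAddCommGroup E] [NormedAddCommGroup G] (F : E → G) : Prop :=
  ∃ a : ℝ, F =O[⊤] fun z => Real.exp (a * ‖z‖)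

namespace ExpGrowth

section Algebra

variable {E G H : Type*} [NormedAddCommGroup E] [NormedAddCommGroup G] [NormedAddCommGroup H]

lemma mono {F : E → G} {F' : E → H} (hF : ExpGrowth F) (h : ∀ z, ‖F' z‖ ≤ ‖F z‖) :
    ExpGrowth F' :=
  hF.imp fun _ ha => (Asymptotics.isBigO_of_le ⊤ h).trans ha

lemma const (c : G) : ExpGrowth (fun _ : E => c) :=
  ⟨0, by simpa using Asymptotics.isBigO_const_const c (one_ne_zero (α := ℝ)) ⊤⟩

lemma exp_norm (a : ℝ) : ExpGrowth (fun z : E => Real.exp (a * ‖z‖)) :=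
  ⟨a, Asymptotics.isBigO_refl _ _⟩

lemma norm {F : E → G} (hF : ExpGrowth F) : ExpGrowth (fun z => ‖F z‖) :=
  hF.mono fun _ => (norm_norm _).le

lemma add {F F' : E → G} (hF : ExpGrowth F) (hF' : ExpGrowth F') :
    ExpGrowth (fun z => F z + F' z) := by
  have exp_mono {a b : ℝ} (hab : a ≤ b) :
      (fun z : E => Real.exp (a * ‖z‖)) =O[⊤] fun z => Real.exp (b * ‖z‖) :=
    Asymptotics.isBigO_of_le _ fun z => by
      simpa using mul_le_mul_of_nonneg_right hab (norm_nonneg z)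
  obtain ⟨a, ha⟩ := hF
  obtain ⟨b, hb⟩ := hF'
  exact ⟨max a b, (ha.trans (exp_mono (le_max_left a b))).add
    (hb.trans (exp_mono (le_max_right a b)))⟩

lemma sub {F F' : E → G} (hF : ExpGrowth F) (hF' : ExpGrowth F') :
    ExpGrowth (fun z => F z - F' z) := by
  simpa only [sub_eq_add_neg] using hF.add (hF'.mono fun z => (norm_neg (F' z)).le)

lemma smul [NormedSpace ℝ G] {c : E → ℝ} {F : E → G} (hc : ExpGrowth c) (hF : ExpGrowth F) :
    ExpGrowth (fun z => c z • F z) := by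
  obtain ⟨a, ha⟩ := hc
  obtain ⟨b, hb⟩ := hF
  exact ⟨a + b, by simpa only [add_mul, Real.exp_add, smul_eq_mul] using ha.smul hb⟩

lemma mul {F F' : E → ℝ} (hF : ExpGrowth F) (hF' : ExpGrowth F') :
    ExpGrowth (fun z => F z * F' z) :=
  hF.smul hF'

lemma norm_rpow {p : ℝ} (hp : 0 ≤ p) : ExpGrowth (fun z : E => ‖z‖ ^ p) :=
  (exp_norm p).mono fun z => by
    rw [Real.norm_of_nonneg (by positivity), Real.norm_of_nonneg (by positivity), mul_comm,
      Real.exp_mul]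
    gcongr
    linarith [Real.add_one_le_exp ‖z‖]

lemma of_norm_le_rpow {F : E → G} {C p : ℝ} (hp : 0 ≤ p) (h : ∀ z, ‖F z‖ ≤ C * ‖z‖ ^ p) :
    ExpGrowth F :=
  ((const C).mul (norm_rpow hp)).mono fun z => (h z).trans (le_abs_self _)

lemma norm_pow (k : ℕ) : ExpGrowth (fun z : E => ‖z‖ ^ k) := by
  simpa using norm_rpow (E := E) k.cast_nonneg

lemma norm_sq_pow (k : ℕ) : ExpGrowth (fun z : E => (‖z‖ ^ 2) ^ k) := by
  simpa only [pow_mul] using norm_pow (E := E) (2 * k)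

lemma continuousLinearMap [NormedSpace ℝ E] [NormedSpace ℝ G] (T : E →L[ℝ] G) : ExpGrowth T :=
  ((const ‖T‖).mul (norm_pow 1)).mono fun z => by simpa using T.le_opNorm z

lemma exists_norm_comp_affine_le [NormedSpace ℝ E] {F : E → G} (hF : ExpGrowth F) (R μ : ℝ) :
    ∃ C a : ℝ, ∀ x u, ‖x‖ ≤ R → ‖F (x + μ • u)‖ ≤ C * Real.exp (a * ‖u‖) := by
  obtain ⟨a, ha⟩ := hF
  obtain ⟨C, hC⟩ := Asymptotics.isBigO_top.1 ha
  have hC₀ : 0 ≤ C := nonneg_of_mul_nonneg_left ((norm_nonneg _).trans (hC 0)) (by simp)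
  refine ⟨C * Real.exp (|a| * R), |a| * |μ|, fun x u hx => (hC _).trans ?_⟩
  rw [Real.norm_of_nonneg (Real.exp_pos _).le, mul_assoc, ← Real.exp_add]
  gcongr
  calc a * ‖x + μ • u‖ ≤ |a| * (R + ‖μ • u‖) := by
        gcongr
        exacts [le_abs_self a, (norm_add_le _ _).trans (by gcongr)]
    _ = |a| * R + |a| * |μ| * ‖u‖ := by
        rw [norm_smul, Real.norm_eq_abs]
        ring

lemma comp_affine [NormedSpace ℝ E] {F : E → G} (hF : ExpGrowth F) (x : E) (μ : ℝ) :
    ExpGrowth (fun u => F (x + μ • u)) := by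
  obtain ⟨C, a, h⟩ := hF.exists_norm_comp_affine_le ‖x‖ μ
  exact ⟨a, Asymptotics.isBigO_top.2 ⟨C, fun u => by simpa using h x u le_rfl⟩⟩

end Algebra

section Integral

variable {E G : Type*} [NormedAddCommGroup E] [InnerProductSpace ℝ E] [FiniteDimensional ℝ E]
  [MeasurableSpace E] [BorelSpace E] [NormedAddCommGroup G]

lemma integrable {F : E → G} (hF : ExpGrowth F) (hm : AEStronglyMeasurable F (stdGaussian E)) :
    Integrable F (stdGaussian E) := by
  obtain ⟨a, ha⟩ := hF
  obtain ⟨C, hC⟩ := Asymptotics.isBigO_top.1 ha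
  refine ((integrable_exp_mul_norm_stdGaussian a).const_mul C).mono' hm
    (Eventually.of_forall fun z => ?_)
  simpa using hC z

lemma integrable_comp_affine [MeasurableSpace G] [BorelSpace G] [SecondCountableTopology G]
    {F : E → G} (hF : ExpGrowth F) (hm : Measurable F) (x : E) (μ : ℝ) :
    Integrable (fun u => F (x + μ • u)) (stdGaussian E) :=
  (hF.comp_affine x μ).integrable (hm.comp (by fun_prop)).aestronglyMeasurable

end Integral

end ExpGrowth

end ExpGrowth

section Differentiation

section Density

variable {E : Type*} [NormedAddCommGroup E] [InnerProductSpace ℝ E]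

lemma hasFDerivAt_exp_inner_sub (u y : E) :
    HasFDerivAt (fun y : E => Real.exp (⟪u, y⟫ - ‖y‖ ^ 2 / 2))
      (Real.exp (⟪u, y⟫ - ‖y‖ ^ 2 / 2) • innerSL ℝ (u - y)) y := by
  have norm_sq : HasFDerivAt (fun y : E => ‖y‖ ^ 2 / 2) (innerSL ℝ y) y := by
    simp_rw [div_eq_inv_mul]
    refine ((hasStrictFDerivAt_norm_sq y).hasFDerivAt.const_mul (2⁻¹ : ℝ)).congr_fderiv ?_
    ext w
    simp
  rw [map_sub]
  exact ((innerSL ℝ u).hasFDerivAt.sub norm_sq).exp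

lemma norm_exp_inner_sub_smul_le {u y : E} (hy : ‖y‖ ≤ 1) :
    ‖Real.exp (⟪u, y⟫ - ‖y‖ ^ 2 / 2) • innerSL ℝ (u - y)‖ ≤ Real.exp ‖u‖ * (‖u‖ + 1) := by
  rw [norm_smul, Real.norm_of_nonneg (Real.exp_pos _).le, innerSL_apply_norm]
  gcongr
  · calc ⟪u, y⟫ - ‖y‖ ^ 2 / 2 ≤ ‖u‖ * ‖y‖ := by nlinarith [real_inner_le_norm u y]
      _ ≤ ‖u‖ := mul_le_of_le_one_right (norm_nonneg u) hy
  · exact (norm_sub_le u y).trans (by gcongr)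

end Density

variable {E : Type*} [NormedAddCommGroup E] [InnerProductSpace ℝ E] [FiniteDimensional ℝ E]
  [MeasurableSpace E] [BorelSpace E]

lemma hasFDerivAt_smoothed {f : E → ℝ} (hd : Differentiable ℝ f) (hf : ExpGrowth f)
    (hf' : ExpGrowth (fderiv ℝ f)) (μ : ℝ) (x : E) :
    HasFDerivAt (smoothed f μ) (∫ u, fderiv ℝ f (x + μ • u) ∂(stdGaussian E)) x := by
  obtain ⟨C, a, bound⟩ := hf'.exists_norm_comp_affine_le (‖x‖ + 1) μ
  rw [show smoothed f μ = fun x => ∫ u, f (x + μ • u) ∂(stdGaussian E) from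
    funext (smoothed_eq_integral f μ)]
  refine hasFDerivAt_integral_of_dominated_of_fderiv_le (F := fun x u => f (x + μ • u))
    (F' := fun x u => fderiv ℝ f (x + μ • u)) (Metric.ball_mem_nhds x one_pos)
    (Eventually.of_forall fun y => (hd.continuous.comp (by fun_prop)).aestronglyMeasurable)
    (hf.integrable_comp_affine hd.continuous.measurable x μ)
    ((measurable_fderiv ℝ f).comp (by fun_prop)).aestronglyMeasurable
    (Eventually.of_forall fun u y hy => bound y u ?_)
    ((integrable_exp_mul_norm_stdGaussian a).const_mul C)
    (Eventually.of_forall fun u y _ => ?_)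
  · rw [mem_ball_iff_norm] at hy
    linarith [norm_le_norm_add_norm_sub' y x]
  · exact (hasFDerivAt_comp_add_right (μ • u)).2 (hd (y + μ • u)).hasFDerivAt

lemma hasFDerivAt_integral_exp_inner_mul {g : E → ℝ} (hg : ExpGrowth g) (hm : Measurable g) :
    HasFDerivAt (fun y => ∫ u, Real.exp (⟪u, y⟫ - ‖y‖ ^ 2 / 2) * g u ∂(stdGaussian E))
      (∫ u, g u • innerSL ℝ u ∂(stdGaussian E)) 0 := by
  have h := hasFDerivAt_integral_of_dominated_of_fderiv_le (μ := stdGaussian E) (x₀ := (0 : E))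
    (F := fun y u => Real.exp (⟪u, y⟫ - ‖y‖ ^ 2 / 2) * g u)
    (F' := fun y u => g u • Real.exp (⟪u, y⟫ - ‖y‖ ^ 2 / 2) • innerSL ℝ (u - y))
    (bound := fun u => ‖g u‖ * (Real.exp ‖u‖ * (‖u‖ + 1)))
    (Metric.ball_mem_nhds 0 one_pos) ?_ ?_ ?_ ?_ ?_ ?_
  · simpa using h
  · exact Eventually.of_forall fun y => by fun_prop
  · simpa using hg.integrable hm.aestronglyMeasurable
  · exact (hm.smul (by fun_prop)).aestronglyMeasurable
  · refine Eventually.of_forall fun u y hy => ?_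
    rw [norm_smul]
    gcongr
    exact norm_exp_inner_sub_smul_le (mem_ball_zero_iff.1 hy).le
  · have exp_norm : ExpGrowth (fun u : E => Real.exp ‖u‖) := by simpa using ExpGrowth.exp_norm 1
    have norm_add_one : ExpGrowth (fun u : E => ‖u‖ + 1) := by
      simpa using (ExpGrowth.norm_pow 1).add (ExpGrowth.const (1 : ℝ))
    exact (hg.norm.mul (exp_norm.mul norm_add_one)).integrable (by fun_prop)
  · exact Eventually.of_forall fun u y _ => (hasFDerivAt_exp_inner_sub u y).mul_const (g u)

lemma hasFDerivAt_smoothed_of_measurable {F : E → ℝ} (hF : ExpGrowth F) (hm : Measurable F)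
    {μ : ℝ} (hμ : μ ≠ 0) (x : E) :
    HasFDerivAt (smoothed F μ)
      (μ⁻¹ • ∫ u, F (x + μ • u) • innerSL ℝ u ∂(stdGaussian E)) x := by
  have shift (z : E) : smoothed F μ z = ∫ u, Real.exp (⟪u, μ⁻¹ • (z - x)⟫ -
      ‖μ⁻¹ • (z - x)‖ ^ 2 / 2) * F (x + μ • u) ∂(stdGaussian E) := by
    have h := integral_add_stdGaussian (fun u => F (x + μ • u)) (μ⁻¹ • (z - x))
    simp only [smul_add, smul_inv_smul₀ hμ, smul_eq_mul] at h
    rw [← h, smoothed_eq_integral]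
    congr 1 with u
    abel_nf
  have inner_deriv : HasFDerivAt (fun z : E => μ⁻¹ • (z - x))
      (μ⁻¹ • ContinuousLinearMap.id ℝ E) x :=
    ((hasFDerivAt_id x).sub_const x).const_smul _
  have outer_deriv := hasFDerivAt_integral_exp_inner_mul (hF.comp_affine x μ)
    (hm.comp (by fun_prop))
  rw [funext shift]
  refine (HasFDerivAt.comp x (by rwa [sub_self, smul_zero]) inner_deriv).congr_fderiv ?_
  rw [ContinuousLinearMap.comp_smul, ContinuousLinearMap.comp_id]

/-- Stein's identity, the first-order integration by parts formula of Gaussian analysis. -/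
lemma integral_fderiv_apply_stdGaussian {f : E → ℝ} (hd : Differentiable ℝ f) (hf : ExpGrowth f)
    (hf' : ExpGrowth (fderiv ℝ f)) (w : E) :
    ∫ u, fderiv ℝ f u w ∂(stdGaussian E) = ∫ u, f u * ⟪u, w⟫ ∂(stdGaussian E) := by
  have hfm := hd.continuous.measurable
  have deriv_eq : ∫ u, fderiv ℝ f u ∂(stdGaussian E) =
      ∫ u, f u • innerSL ℝ u ∂(stdGaussian E) := by
    simpa using (hasFDerivAt_smoothed hd hf hf' 1 0).unique
      (hasFDerivAt_smoothed_of_measurable hf hfm one_ne_zero 0)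
  have integrable_smul : Integrable (fun u => f u • innerSL ℝ u) (stdGaussian E) :=
    (hf.smul (ExpGrowth.continuousLinearMap (innerSL ℝ))).integrable
      (hfm.smul (by fun_prop)).aestronglyMeasurable
  rw [← ContinuousLinearMap.integral_apply
    (hf'.integrable (measurable_fderiv ℝ f).aestronglyMeasurable), deriv_eq,
    ContinuousLinearMap.integral_apply integrable_smul]
  simp

end Differentiation

section Moments

section NormSqPow

variable {E : Type*} [NormedAddCommGroup E] [InnerProductSpace ℝ E]

lemma hasFDerivAt_norm_sq_pow_mul_inner (k : ℕ) (a u : E) :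
    HasFDerivAt (fun u : E => (‖u‖ ^ 2) ^ k * ⟪a, u⟫)
      ((‖u‖ ^ 2) ^ k • innerSL ℝ a + (2 * k * (‖u‖ ^ 2) ^ (k - 1) * ⟪a, u⟫) • innerSL ℝ u) u := by
  refine (((hasStrictFDerivAt_norm_sq u).hasFDerivAt.pow k).mul
    (innerSL ℝ a).hasFDerivAt).congr_fderiv ?_
  ext w
  simp
  ring

lemma expGrowth_inner (a : E) : ExpGrowth (fun u : E => ⟪a, u⟫) :=
  ExpGrowth.continuousLinearMap (innerSL ℝ a)

end NormSqPow

variable {E : Type*} [NormedAddCommGroup E] [InnerProductSpace ℝ E] [FiniteDimensional ℝ E]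
  [MeasurableSpace E] [BorelSpace E]

lemma integrable_norm_sq_pow (k : ℕ) : Integrable (fun u : E => (‖u‖ ^ 2) ^ k) (stdGaussian E) :=
  (ExpGrowth.norm_sq_pow k).integrable (by fun_prop)

lemma integrable_norm_sq_pow_mul_inner_sq (k : ℕ) (a : E) :
    Integrable (fun u => (‖u‖ ^ 2) ^ k * ⟪a, u⟫ ^ 2) (stdGaussian E) := by
  simp_rw [sq ⟪a, _⟫]
  exact ((ExpGrowth.norm_sq_pow k).mul ((expGrowth_inner a).mul (expGrowth_inner a))).integrable
    (by fun_prop)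

lemma integral_norm_sq_pow_mul_inner_sq (k : ℕ) (a : E) :
    ∫ u, (‖u‖ ^ 2) ^ k * ⟪a, u⟫ ^ 2 ∂(stdGaussian E) =
      ‖a‖ ^ 2 * ∫ u, (‖u‖ ^ 2) ^ k ∂(stdGaussian E) +
        2 * k * ∫ u, (‖u‖ ^ 2) ^ (k - 1) * ⟪a, u⟫ ^ 2 ∂(stdGaussian E) := by
  have deriv (u : E) := hasFDerivAt_norm_sq_pow_mul_inner k a u
  have growth_deriv : ExpGrowth (fderiv ℝ fun u : E => (‖u‖ ^ 2) ^ k * ⟪a, u⟫) := by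
    rw [funext fun u => (deriv u).fderiv]
    exact ((ExpGrowth.norm_sq_pow k).smul (.const _)).add ((((ExpGrowth.const _).mul
      (.norm_sq_pow _)).mul (expGrowth_inner a)).smul (.continuousLinearMap (innerSL ℝ)))
  have stein := integral_fderiv_apply_stdGaussian (fun u => (deriv u).differentiableAt)
    ((ExpGrowth.norm_sq_pow k).mul (expGrowth_inner a)) growth_deriv a
  calc ∫ u, (‖u‖ ^ 2) ^ k * ⟪a, u⟫ ^ 2 ∂(stdGaussian E)
      = ∫ u, (‖u‖ ^ 2) ^ k * ⟪a, u⟫ * ⟪u, a⟫ ∂(stdGaussian E) := by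
        simp only [real_inner_comm a, sq ⟪a, _⟫, mul_assoc]
    _ = ∫ u, (‖a‖ ^ 2 * (‖u‖ ^ 2) ^ k +
          2 * k * ((‖u‖ ^ 2) ^ (k - 1) * ⟪a, u⟫ ^ 2)) ∂(stdGaussian E) := by
        rw [← stein]
        congr 1 with u
        rw [(deriv u).fderiv]
        simp only [add_apply, smul_apply, innerSL_apply_apply, real_inner_self_eq_norm_sq,
          real_inner_comm a, smul_eq_mul]
        ring
    _ = _ := by
        rw [integral_add ((integrable_norm_sq_pow k).const_mul _)
          ((integrable_norm_sq_pow_mul_inner_sq _ a).const_mul _), integral_const_mul,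
          integral_const_mul]

lemma sum_integral_norm_sq_pow_mul_inner_sq (k : ℕ) :
    ∑ i, ∫ u, (‖u‖ ^ 2) ^ k * ⟪stdOrthonormalBasis ℝ E i, u⟫ ^ 2 ∂(stdGaussian E) =
      ∫ u : E, (‖u‖ ^ 2) ^ (k + 1) ∂(stdGaussian E) := by
  rw [← integral_finsetSum _ fun i _ => integrable_norm_sq_pow_mul_inner_sq k _]
  simp_rw [← Finset.mul_sum, OrthonormalBasis.sum_sq_inner_right, pow_succ]

lemma integral_norm_sq_pow_succ (k : ℕ) :
    ∫ u : E, (‖u‖ ^ 2) ^ (k + 1) ∂(stdGaussian E) =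
      (Module.finrank ℝ E + 2 * k) * ∫ u : E, (‖u‖ ^ 2) ^ k ∂(stdGaussian E) := by
  rw [← sum_integral_norm_sq_pow_mul_inner_sq k]
  simp_rw [integral_norm_sq_pow_mul_inner_sq k, OrthonormalBasis.norm_eq_one]
  rw [Finset.sum_add_distrib, ← Finset.mul_sum, ← Finset.mul_sum,
    sum_integral_norm_sq_pow_mul_inner_sq]
  rcases k with _ | k
  · simp
  · simp
    ring

lemma integral_norm_sq : ∫ u : E, ‖u‖ ^ 2 ∂(stdGaussian E) = Module.finrank ℝ E := by
  simpa using integral_norm_sq_pow_succ (E := E) 0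

lemma integral_norm_sq_pow_two :
    ∫ u : E, (‖u‖ ^ 2) ^ 2 ∂(stdGaussian E) =
      Module.finrank ℝ E * (Module.finrank ℝ E + 2) := by
  simpa [integral_norm_sq, mul_comm] using integral_norm_sq_pow_succ (E := E) 1

lemma integral_inner_sq (a : E) : ∫ u, ⟪a, u⟫ ^ 2 ∂(stdGaussian E) = ‖a‖ ^ 2 := by
  simpa using integral_norm_sq_pow_mul_inner_sq 0 a

lemma integral_norm_sq_mul_inner_sq (a : E) :
    ∫ u, ‖u‖ ^ 2 * ⟪a, u⟫ ^ 2 ∂(stdGaussian E) = (Module.finrank ℝ E + 2) * ‖a‖ ^ 2 := by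
  have h := integral_norm_sq_pow_mul_inner_sq 1 a
  simp only [pow_one, integral_norm_sq, Nat.cast_one, mul_one, tsub_self, pow_zero, one_mul,
    integral_inner_sq] at h
  rw [h]
  ring

lemma rpow_le_rpow_mul_one_add {t m θ : ℝ} (ht : 0 ≤ t) (hm : 0 < m) (hθ₀ : 0 ≤ θ) (hθ₁ : θ ≤ 1) :
    t ^ θ ≤ m ^ θ * (1 + θ * (t / m - 1)) := by
  calc t ^ θ = m ^ θ * (1 + (t / m - 1)) ^ θ := by
        rw [add_sub_cancel, ← Real.mul_rpow hm.le (by positivity), mul_div_cancel₀ _ hm.ne']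
    _ ≤ m ^ θ * (1 + θ * (t / m - 1)) := by
        gcongr
        refine rpow_one_add_le_one_add_mul_self ?_ hθ₀ hθ₁
        linarith [div_nonneg ht hm.le]

-- The tangent to `t ↦ t ^ (p / 2)` is taken at the mean `n + 2 k` of `‖u‖ ^ 2` under the measure
-- of density proportional to `‖u‖ ^ (2 k)`.
lemma integral_norm_sq_pow_mul_norm_rpow_le (k : ℕ) {p : ℝ} (hp₀ : 0 ≤ p) (hp₂ : p ≤ 2) :
    ∫ u : E, (‖u‖ ^ 2) ^ k * ‖u‖ ^ p ∂(stdGaussian E) ≤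
      (Module.finrank ℝ E + 2 * k) ^ (p / 2) * ∫ u : E, (‖u‖ ^ 2) ^ k ∂(stdGaussian E) := by
  set m : ℝ := Module.finrank ℝ E + 2 * k with hm
  rcases (by positivity : 0 ≤ m).eq_or_lt with hm₀ | hm₀
  · obtain ⟨hE, rfl⟩ : Module.finrank ℝ E = 0 ∧ k = 0 := by
      constructor <;> rify <;> linarith [(Module.finrank ℝ E).cast_nonneg (α := ℝ),
        k.cast_nonneg (α := ℝ)]
    have := Module.finrank_zero_iff.1 hE
    rcases hp₀.eq_or_lt with rfl | hp
    · simp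
    · simp [Subsingleton.elim _ (0 : E), Real.zero_rpow hp.ne', hm₀.symm, (half_pos hp).ne']
  have tangent (u : E) : (‖u‖ ^ 2) ^ k * ‖u‖ ^ p ≤
      m ^ (p / 2) * ((1 - p / 2) * (‖u‖ ^ 2) ^ k + p / 2 / m * (‖u‖ ^ 2) ^ (k + 1)) := by
    have h := rpow_le_rpow_mul_one_add (sq_nonneg ‖u‖) hm₀ (by linarith : 0 ≤ p / 2) (by linarith)
    rw [← Real.rpow_natCast_mul (norm_nonneg u), Nat.cast_ofNat, mul_div_cancel₀ p two_ne_zero] at h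
    calc (‖u‖ ^ 2) ^ k * ‖u‖ ^ p ≤
        (‖u‖ ^ 2) ^ k * (m ^ (p / 2) * (1 + p / 2 * (‖u‖ ^ 2 / m - 1))) := by gcongr
      _ = _ := by ring
  have integrable_left := (integrable_norm_sq_pow (E := E) k).const_mul (1 - p / 2)
  have integrable_right := (integrable_norm_sq_pow (E := E) (k + 1)).const_mul (p / 2 / m)
  calc ∫ u : E, (‖u‖ ^ 2) ^ k * ‖u‖ ^ p ∂(stdGaussian E)
      ≤ ∫ u : E, m ^ (p / 2) * ((1 - p / 2) * (‖u‖ ^ 2) ^ k +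
          p / 2 / m * (‖u‖ ^ 2) ^ (k + 1)) ∂(stdGaussian E) :=
        integral_mono_of_nonneg (Eventually.of_forall fun u => by positivity)
          ((integrable_left.add integrable_right).const_mul _) (Eventually.of_forall tangent)
    _ = m ^ (p / 2) * ∫ u : E, (‖u‖ ^ 2) ^ k ∂(stdGaussian E) := by
        rw [integral_const_mul, integral_add integrable_left integrable_right, integral_const_mul,
          integral_const_mul, integral_norm_sq_pow_succ, ← hm]
        field_simp
        ring

lemma integral_norm_rpow_le {p : ℝ} (hp₀ : 0 ≤ p) (hp₂ : p ≤ 2) :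
    ∫ u : E, ‖u‖ ^ p ∂(stdGaussian E) ≤ (Module.finrank ℝ E : ℝ) ^ (p / 2) := by
  simpa using integral_norm_sq_pow_mul_norm_rpow_le (E := E) 0 hp₀ hp₂

end Moments

lemma norm_smul_rpow {V : Type*} [SeminormedAddCommGroup V] [NormedSpace ℝ V] {t : ℝ} (ht : 0 ≤ t)
    (u : V) (p : ℝ) : ‖t • u‖ ^ p = t ^ p * ‖u‖ ^ p := by
  rw [norm_smul, Real.norm_of_nonneg ht, Real.mul_rpow ht (norm_nonneg u)]

section Taylor

variable {E : Type*} [NormedAddCommGroup E] [InnerProductSpace ℝ E] {f : E → ℝ} {ν L : ℝ}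

namespace HasHolderGradient

lemma norm_fderiv_add_smul_sub_le (hf : HasHolderGradient f ν L) (x d : E) {t : ℝ} (ht : 0 ≤ t) :
    ‖fderiv ℝ f (x + t • d) - fderiv ℝ f x‖ ≤ L * ‖d‖ ^ ν * t ^ ν := by
  have h := hf.2 x (x + t • d)
  rwa [add_sub_cancel_left, norm_smul_rpow ht, mul_comm (t ^ ν), ← mul_assoc] at h

lemma abs_sub_sub_fderiv_le (hf : HasHolderGradient f ν L) (hν : 0 ≤ ν) (x y : E) :
    |f y - f x - fderiv ℝ f x (y - x)| ≤ L / (1 + ν) * ‖y - x‖ ^ (1 + ν) := by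
  set d := y - x with hd
  have hν' : 1 + ν ≠ 0 := by positivity
  have remainder_deriv (t : ℝ) :
      HasDerivAt (fun t : ℝ => f (x + t • d) - f x - t * fderiv ℝ f x d)
        ((fderiv ℝ f (x + t • d) - fderiv ℝ f x) d) t := by
    have line : HasDerivAt (fun t : ℝ => x + t • d) d t := by
      simpa using ((hasDerivAt_id t).smul_const d).const_add x
    have f_line := ((hf.1 (x + t • d)).hasFDerivAt.comp_hasDerivAt t line).sub_const (f x)
    exact (f_line.sub ((hasDerivAt_id t).mul_const (fderiv ℝ f x d))).congr_deriv (by simp)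
  have bound_deriv (t : ℝ) :
      HasDerivAt (fun t : ℝ => L / (1 + ν) * ‖d‖ ^ (1 + ν) * t ^ (1 + ν))
        (L * ‖d‖ ^ (1 + ν) * t ^ ν) t := by
    refine ((Real.hasDerivAt_rpow_const (x := t) (p := 1 + ν) (Or.inr (by linarith))).const_mul
      (L / (1 + ν) * ‖d‖ ^ (1 + ν))).congr_deriv ?_
    rw [add_sub_cancel_left]
    field_simp
  have deriv_le (t : ℝ) (ht : t ∈ Set.Ico (0 : ℝ) 1) :
      ‖(fderiv ℝ f (x + t • d) - fderiv ℝ f x) d‖ ≤ L * ‖d‖ ^ (1 + ν) * t ^ ν := by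
    refine ((fderiv ℝ f (x + t • d) - fderiv ℝ f x).le_of_opNorm_le
      (hf.norm_fderiv_add_smul_sub_le x d ht.1) d).trans_eq ?_
    rw [add_comm 1 ν, Real.rpow_add_one' (norm_nonneg _) (by positivity)]
    ring
  simpa [hd] using image_norm_le_of_norm_deriv_right_le_deriv_boundary (a := 0) (b := 1)
    (fun t _ => (remainder_deriv t).continuousAt.continuousWithinAt)
    (fun t _ => (remainder_deriv t).hasDerivWithinAt) (by simp [hν']) bound_deriv deriv_le
    (Set.right_mem_Icc.2 zero_le_one)

lemma expGrowth_fderiv (hf : HasHolderGradient f ν L) (hν : 0 ≤ ν) : ExpGrowth (fderiv ℝ f) := by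
  have increment : ExpGrowth fun z => fderiv ℝ f z - fderiv ℝ f 0 :=
    .of_norm_le_rpow hν fun z => by simpa using hf.2 0 z
  simpa only [sub_add_cancel] using increment.add (.const (fderiv ℝ f 0))

lemma expGrowth (hf : HasHolderGradient f ν L) (hν : 0 ≤ ν) : ExpGrowth f := by
  have remainder : ExpGrowth fun z => f z - f 0 - fderiv ℝ f 0 z :=
    .of_norm_le_rpow (by positivity : 0 ≤ 1 + ν) fun z => by
      simpa using hf.abs_sub_sub_fderiv_le hν 0 z
  simpa using (remainder.add (.continuousLinearMap (fderiv ℝ f 0))).add (.const (f 0))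

lemma expGrowth_fderiv_apply (hf : HasHolderGradient f ν L) (hν : 0 ≤ ν) (v : E) :
    ExpGrowth (fun z => fderiv ℝ f z v) :=
  ((hf.expGrowth_fderiv hν).norm.mul (.const ‖v‖)).mono fun z => by
    simpa using (fderiv ℝ f z).le_opNorm v

lemma abs_fderiv_apply_sub_le (hf : HasHolderGradient f ν L) (v x y : E) :
    |fderiv ℝ f y v - fderiv ℝ f x v| ≤ L * ‖v‖ * ‖y - x‖ ^ ν :=
  ((fderiv ℝ f y - fderiv ℝ f x).le_of_opNorm_le (hf.2 x y) v).trans_eq (mul_right_comm _ _ _)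

end HasHolderGradient

end Taylor

section Smoothing

variable {E : Type*} [NormedAddCommGroup E] [InnerProductSpace ℝ E] [FiniteDimensional ℝ E]
  [MeasurableSpace E] [BorelSpace E]

lemma integrable_norm_rpow {p : ℝ} (hp : 0 ≤ p) :
    Integrable (fun u : E => ‖u‖ ^ p) (stdGaussian E) :=
  (ExpGrowth.norm_rpow hp).integrable (by fun_prop)

lemma abs_smoothed_sub_le {F : E → ℝ} {x : E} {μ C p : ℝ} (hμ : 0 ≤ μ) (hC : 0 ≤ C) (hp₀ : 0 ≤ p)
    (hp₂ : p ≤ 2) (hF : Integrable (fun u => F (x + μ • u)) (stdGaussian E)) (T : StrongDual ℝ E)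
    (hT : ∀ y, |F y - F x - T (y - x)| ≤ C * ‖y - x‖ ^ p) :
    |smoothed F μ x - F x| ≤ C * μ ^ p * (Module.finrank ℝ E : ℝ) ^ (p / 2) := by
  have integrable_linear : Integrable (fun u => T (μ • u)) (stdGaussian E) :=
    (ExpGrowth.continuousLinearMap (T ∘L (μ • ContinuousLinearMap.id ℝ E))).integrable
      (by fun_prop)
  have integrable_increment : Integrable (fun u => F (x + μ • u) - F x) (stdGaussian E) :=
    hF.sub (integrable_const _)
  have smoothed_sub : smoothed F μ x - F x =
      ∫ u, (F (x + μ • u) - F x - T (μ • u)) ∂(stdGaussian E) := by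
    rw [integral_sub integrable_increment integrable_linear, integral_sub hF (integrable_const _),
      smoothed_eq_integral]
    simp [integral_const_mul, integral_strongDual_stdGaussian]
  calc |smoothed F μ x - F x| ≤ ∫ u : E, C * μ ^ p * ‖u‖ ^ p ∂(stdGaussian E) := by
        rw [smoothed_sub, ← Real.norm_eq_abs]
        refine norm_integral_le_of_norm_le ((integrable_norm_rpow hp₀).const_mul _)
          (Eventually.of_forall fun u => ?_)
        simpa only [add_sub_cancel_left, norm_smul_rpow hμ, ← mul_assoc, Real.norm_eq_abs] using
          hT (x + μ • u)
    _ ≤ C * μ ^ p * (Module.finrank ℝ E : ℝ) ^ (p / 2) := by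
        rw [integral_const_mul]
        gcongr
        exact integral_norm_rpow_le hp₀ hp₂

lemma integral_smul_innerSL_sub_const {g : E → ℝ} (hg : ExpGrowth g) (hm : Measurable g) (c : ℝ) :
    ∫ u, (g u - c) • innerSL ℝ u ∂(stdGaussian E) = ∫ u, g u • innerSL ℝ u ∂(stdGaussian E) := by
  have integrable_smul : Integrable (fun u => g u • innerSL ℝ u) (stdGaussian E) :=
    (hg.smul (.continuousLinearMap (innerSL ℝ))).integrable
      (hm.smul (by fun_prop)).aestronglyMeasurable
  have integrable_innerSL : Integrable (fun u : E => innerSL ℝ u) (stdGaussian E) :=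
    (ExpGrowth.continuousLinearMap (innerSL ℝ)).integrable (by fun_prop)
  have mean_zero : ∫ u : E, innerSL ℝ u ∂(stdGaussian E) = 0 := by
    have integrable_id : Integrable (fun u : E => u) (stdGaussian E) :=
      IsGaussian.integrable_fun_id
    rw [(innerSL ℝ).integral_comp_comm integrable_id, integral_id_stdGaussian, map_zero]
  simp_rw [sub_smul]
  rw [integral_sub integrable_smul (integrable_innerSL.fun_smul c), integral_smul, mean_zero,
    smul_zero, sub_zero]

lemma norm_fderiv_smoothed_le {F : E → ℝ} {x : E} {μ C ν : ℝ} (hμ : 0 < μ) (hC : 0 ≤ C)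
    (hν₀ : 0 ≤ ν) (hν₁ : ν ≤ 1) (hF : ExpGrowth F) (hm : Measurable F)
    (hx : ∀ y, |F y - F x| ≤ C * ‖y - x‖ ^ ν) :
    ‖fderiv ℝ (smoothed F μ) x‖ ≤ smoothConst ν C (Module.finrank ℝ E) μ := by
  rw [(hasFDerivAt_smoothed_of_measurable hF hm hμ.ne' x).fderiv, norm_smul,
    Real.norm_of_nonneg (by positivity), ← integral_smul_innerSL_sub_const (hF.comp_affine x μ)
      (hm.comp (by fun_prop)) (F x)]
  have norm_le (u : E) : ‖(F (x + μ • u) - F x) • innerSL ℝ u‖ ≤ C * μ ^ ν * ‖u‖ ^ (1 + ν) := by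
    have h := hx (x + μ • u)
    rw [add_sub_cancel_left, norm_smul_rpow hμ.le] at h
    rw [norm_smul, innerSL_apply_norm, add_comm 1 ν,
      Real.rpow_add_one' (norm_nonneg u) (by positivity), ← mul_assoc, mul_assoc C]
    gcongr
    exact h
  calc μ⁻¹ * ‖∫ u, (F (x + μ • u) - F x) • innerSL ℝ u ∂(stdGaussian E)‖
      ≤ μ⁻¹ * ∫ u : E, C * μ ^ ν * ‖u‖ ^ (1 + ν) ∂(stdGaussian E) := by
        gcongr
        exact norm_integral_le_of_norm_le ((integrable_norm_rpow (by positivity)).const_mul _)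
          (Eventually.of_forall norm_le)
    _ ≤ μ⁻¹ * (C * μ ^ ν * (Module.finrank ℝ E : ℝ) ^ ((1 + ν) / 2)) := by
        rw [integral_const_mul]
        gcongr
        exact integral_norm_rpow_le (by positivity) (by linarith)
    _ = smoothConst ν C (Module.finrank ℝ E) μ := by
        rw [smoothConst, Real.rpow_sub hμ, Real.rpow_one]
        field_simp

namespace HasHolderGradient

variable {f : E → ℝ} {ν L μ : ℝ}

lemma integrable_comp_affine (hf : HasHolderGradient f ν L) (hν : 0 ≤ ν) (x : E) (μ : ℝ) :
    Integrable (fun u => f (x + μ • u)) (stdGaussian E) :=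
  (hf.expGrowth hν).integrable_comp_affine hf.1.continuous.measurable x μ

lemma integrable_mul_exp (hf : HasHolderGradient f ν L) (hν : 0 ≤ ν) (μ : ℝ) (x : E) :
    Integrable fun u : E => f (x + μ • u) * Real.exp (-(1 / 2) * ‖u‖ ^ 2) := by
  simpa only [smul_eq_mul, mul_comm] using
    integrable_stdGaussian_iff.1 (hf.integrable_comp_affine hν x μ)

lemma differentiable_smoothed (hf : HasHolderGradient f ν L) (hν : 0 ≤ ν) (μ : ℝ) :
    Differentiable ℝ (smoothed f μ) := fun x =>
  (hasFDerivAt_smoothed hf.1 (hf.expGrowth hν) (hf.expGrowth_fderiv hν) μ x).differentiableAt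

lemma fderiv_smoothed_apply (hf : HasHolderGradient f ν L) (hν : 0 ≤ ν) (μ : ℝ) (x v : E) :
    fderiv ℝ (smoothed f μ) x v = smoothed (fun z => fderiv ℝ f z v) μ x := by
  have hf' := hf.expGrowth_fderiv hν
  rw [(hasFDerivAt_smoothed hf.1 (hf.expGrowth hν) hf' μ x).fderiv, smoothed_eq_integral,
    ContinuousLinearMap.integral_apply
      (hf'.integrable_comp_affine (measurable_fderiv ℝ f) x μ)]

lemma abs_smoothed_sub_le_gapBound (hf : HasHolderGradient f ν L) (hν₀ : 0 ≤ ν) (hν₁ : ν ≤ 1)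
    (hL : 0 ≤ L) (hμ : 0 ≤ μ) (x : E) :
    |smoothed f μ x - f x| ≤ gapBound ν L (Module.finrank ℝ E) μ :=
  abs_smoothed_sub_le hμ (by positivity) (by positivity) (by linarith)
    (hf.integrable_comp_affine hν₀ x μ) (fderiv ℝ f x) (hf.abs_sub_sub_fderiv_le hν₀ x)

lemma norm_fderiv_smoothed_sub_le (hf : HasHolderGradient f ν L) (hν₀ : 0 ≤ ν) (hν₁ : ν ≤ 1)
    (hL : 0 ≤ L) (hμ : 0 ≤ μ) (x : E) :
    ‖fderiv ℝ (smoothed f μ) x - fderiv ℝ f x‖ ≤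
      L * μ ^ ν * (Module.finrank ℝ E : ℝ) ^ (ν / 2) := by
  refine ContinuousLinearMap.opNorm_le_bound _ (by positivity) fun v => ?_
  rw [sub_apply, hf.fderiv_smoothed_apply hν₀]
  refine (abs_smoothed_sub_le hμ (by positivity) hν₀ (by linarith)
    ((hf.expGrowth_fderiv_apply hν₀ v).integrable_comp_affine (measurable_fderiv_apply_const ℝ f v)
      x μ) 0 fun y => ?_).trans_eq (by ring : L * ‖v‖ * μ ^ ν * _ = _)
  simpa using hf.abs_fderiv_apply_sub_le v x y

lemma smoothed (hf : HasHolderGradient f ν L) (hν₀ : 0 ≤ ν) (hν₁ : ν ≤ 1) (hL : 0 ≤ L)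
    (hμ : 0 < μ) :
    HasHolderGradient (smoothed f μ) 1 (smoothConst ν L (Module.finrank ℝ E) μ) := by
  refine ⟨hf.differentiable_smoothed hν₀ μ, fun x y => ?_⟩
  have const_nonneg : 0 ≤ smoothConst ν L (Module.finrank ℝ E) μ := by
    unfold smoothConst
    positivity
  refine ContinuousLinearMap.opNorm_le_bound _ (by positivity) fun v => ?_
  have growth := hf.expGrowth_fderiv_apply hν₀ v
  have meas := measurable_fderiv_apply_const ℝ f v
  rw [sub_apply, hf.fderiv_smoothed_apply hν₀, hf.fderiv_smoothed_apply hν₀, Real.rpow_one]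
  refine (convex_univ.norm_image_sub_le_of_norm_fderiv_le (𝕜 := ℝ)
    (fun z _ => (hasFDerivAt_smoothed_of_measurable growth meas hμ.ne' z).differentiableAt)
    (fun z _ => norm_fderiv_smoothed_le hμ (by positivity) hν₀ hν₁ growth meas
      (hf.abs_fderiv_apply_sub_le v z)) (Set.mem_univ x) (Set.mem_univ y)).trans_eq ?_
  rw [smoothConst, smoothConst]
  ring

end HasHolderGradient

end Smoothing

section RandomIteration

variable {Ω S α : Type*} [MeasurableSpace Ω] [MeasurableSpace S] [MeasurableSpace α]
  {P : Measure Ω} {γ : Measure S}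

/-- The random recursion `X (k + 1) = Φ (X k) (U k)` from `X 0 = x₀`, driven by independent noises
`U k` of law `γ`. -/
structure IsRandomIteration (γ : Measure S) (Φ : α → S → α) (x₀ : α) (P : Measure Ω)
    (U : ℕ → Ω → S) (X : ℕ → Ω → α) : Prop where
  hasLaw : ∀ k, HasLaw (U k) γ P
  iIndepFun : iIndepFun U P
  zero : ∀ ω, X 0 ω = x₀
  succ : ∀ k ω, X (k + 1) ω = Φ (X k ω) (U k ω)

namespace IsRandomIteration

variable {Φ : α → S → α} {x₀ : α} {U : ℕ → Ω → S} {X : ℕ → Ω → α}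

lemma exists_measurable (hX : IsRandomIteration γ Φ x₀ P U X)
    (hΦ : Measurable (Function.uncurry Φ)) (k : ℕ) :
    ∃ Ψ : (Finset.range k → S) → α, Measurable Ψ ∧ ∀ ω, X k ω = Ψ fun j => U j ω := by
  induction k with
  | zero => exact ⟨fun _ => x₀, measurable_const, hX.zero⟩
  | succ k ih =>
    obtain ⟨Ψ, hΨ, past⟩ := ih
    have subset : Finset.range k ⊆ Finset.range (k + 1) := Finset.range_mono k.le_succ
    let last : Finset.range (k + 1) := ⟨k, Finset.self_mem_range_succ k⟩
    refine ⟨fun v => Φ (Ψ (Finset.restrict₂ (π := fun _ => S) subset v)) (v last), ?_, fun ω => ?_⟩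
    · exact hΦ.comp ((hΨ.comp (Finset.measurable_restrict₂ subset)).prodMk
        (measurable_pi_apply last))
    · rw [hX.succ, past]
      rfl

lemma aemeasurable (hX : IsRandomIteration γ Φ x₀ P U X) (hΦ : Measurable (Function.uncurry Φ))
    (k : ℕ) : AEMeasurable (X k) P := by
  obtain ⟨Ψ, hΨ, past⟩ := hX.exists_measurable hΦ k
  rw [funext past]
  exact hΨ.comp_aemeasurable (aemeasurable_pi_lambda _ fun j => (hX.hasLaw j).aemeasurable)

lemma indepFun (hX : IsRandomIteration γ Φ x₀ P U X) (hΦ : Measurable (Function.uncurry Φ))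
    (k : ℕ) : IndepFun (X k) (U k) P := by
  obtain ⟨Ψ, hΨ, past⟩ := hX.exists_measurable hΦ k
  rw [funext past]
  exact (hX.iIndepFun.indepFun_finset₀ (Finset.range k) {k} (by simp)
    fun j => (hX.hasLaw j).aemeasurable).comp hΨ
      (measurable_pi_apply (⟨k, Finset.mem_singleton_self k⟩ : ({k} : Finset ℕ)))

lemma hasLaw_prodMk [IsFiniteMeasure P] (hX : IsRandomIteration γ Φ x₀ P U X)
    (hΦ : Measurable (Function.uncurry Φ)) (k : ℕ) :
    HasLaw (fun ω => (X k ω, U k ω)) ((P.map (X k)).prod γ) P :=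
  IndepFun.hasLaw_prod ⟨hX.aemeasurable hΦ k, rfl⟩ (hX.hasLaw k) (hX.indepFun hΦ k)

end IsRandomIteration

variable {X : Ω → α} {U : Ω → S} {φ : α → S → ℝ} {ψ : α → ℝ} [SFinite γ]

lemma integrable_comp_prodMk_of_integral_le (hX : AEMeasurable X P)
    (hXU : HasLaw (fun ω => (X ω, U ω)) ((P.map X).prod γ) P)
    (hφ : Measurable (Function.uncurry φ)) (nonneg : ∀ x s, 0 ≤ φ x s)
    (integrable : ∀ x, Integrable (φ x) γ) (integral_le : ∀ x, ∫ s, φ x s ∂γ ≤ ψ x)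
    (hψ : Measurable ψ) (integrable_bound : Integrable (fun ω => ψ (X ω)) P) :
    Integrable (fun ω => φ (X ω) (U ω)) P := by
  refine Integrable.comp_aemeasurable (f := fun ω => (X ω, U ω)) (g := Function.uncurry φ) ?_
    hXU.aemeasurable
  rw [hXU.map_eq, integrable_prod_iff hφ.aestronglyMeasurable]
  refine ⟨Eventually.of_forall integrable, ?_⟩
  refine ((integrable_map_measure hψ.aestronglyMeasurable hX).2 integrable_bound).mono'
    hφ.stronglyMeasurable.norm.integral_prod_right.aestronglyMeasurable
    (Eventually.of_forall fun x => ?_)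
  simp_rw [Function.uncurry_apply_pair, Real.norm_of_nonneg (nonneg x _)]
  rw [Real.norm_of_nonneg (integral_nonneg (nonneg x))]
  exact integral_le x

lemma integral_comp_prodMk_le [SFinite P] (hX : AEMeasurable X P)
    (hXU : HasLaw (fun ω => (X ω, U ω)) ((P.map X).prod γ) P)
    (hφ : Measurable (Function.uncurry φ)) (hψ : Measurable ψ)
    (integrable_left : Integrable (fun ω => φ (X ω) (U ω)) P)
    (integrable_right : Integrable (fun ω => ψ (X ω)) P)
    (integral_le : ∀ x, ∫ s, φ x s ∂γ ≤ ψ x) :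
    ∫ ω, φ (X ω) (U ω) ∂P ≤ ∫ ω, ψ (X ω) ∂P := by
  have integrable_prod : Integrable (Function.uncurry φ) ((P.map X).prod γ) := by
    rw [← hXU.map_eq]
    exact (integrable_map_measure hφ.aestronglyMeasurable hXU.aemeasurable).2 integrable_left
  calc ∫ ω, φ (X ω) (U ω) ∂P = ∫ x, ∫ s, φ x s ∂γ ∂(P.map X) := by
        exact (hXU.integral_comp hφ.aestronglyMeasurable).trans (integral_prod _ integrable_prod)
    _ ≤ ∫ x, ψ x ∂(P.map X) := integral_mono integrable_prod.integral_prod_left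
        ((integrable_map_measure hψ.aestronglyMeasurable hX).2 integrable_right) integral_le
    _ = ∫ ω, ψ (X ω) ∂P := integral_map hX hψ.aestronglyMeasurable

end RandomIteration

section LipschitzGradient

variable {E : Type*} [NormedAddCommGroup E] [InnerProductSpace ℝ E] {F : E → ℝ} {A : ℝ}

namespace HasHolderGradient

lemma continuous_fderiv (hF : HasHolderGradient F 1 A) : Continuous (fderiv ℝ F) :=
  (LipschitzWith.of_dist_le' fun x y => by
    simpa [dist_eq_norm] using hF.2 y x).continuous

lemma norm_fderiv_sq_le (hF : HasHolderGradient F 1 A) (x : E) :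
    ‖fderiv ℝ F x‖ ^ 2 ≤ 2 * ‖fderiv ℝ F 0‖ ^ 2 + 2 * A ^ 2 * ‖x‖ ^ 2 := by
  have increment : ‖fderiv ℝ F x - fderiv ℝ F 0‖ ≤ A * ‖x‖ := by simpa using hF.2 0 x
  calc ‖fderiv ℝ F x‖ ^ 2 ≤ (‖fderiv ℝ F 0‖ + A * ‖x‖) ^ 2 := by
        gcongr
        linarith [norm_le_norm_add_norm_sub' (fderiv ℝ F x) (fderiv ℝ F 0)]
    _ ≤ 2 * (‖fderiv ℝ F 0‖ ^ 2 + (A * ‖x‖) ^ 2) := add_sq_le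
    _ = 2 * ‖fderiv ℝ F 0‖ ^ 2 + 2 * A ^ 2 * ‖x‖ ^ 2 := by ring

lemma abs_sub_sub_fderiv_le_sq (hF : HasHolderGradient F 1 A) (x d : E) :
    |F (x + d) - F x - fderiv ℝ F x d| ≤ A / 2 * ‖d‖ ^ 2 := by
  simpa [one_add_one_eq_two] using hF.abs_sub_sub_fderiv_le zero_le_one x (x + d)

lemma abs_le (hF : HasHolderGradient F 1 A) (x : E) :
    |F x| ≤ |F 0| + ‖fderiv ℝ F 0‖ + (‖fderiv ℝ F 0‖ + A / 2) * ‖x‖ ^ 2 := by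
  have remainder : |F x - F 0 - fderiv ℝ F 0 x| ≤ A / 2 * ‖x‖ ^ 2 := by
    simpa using hF.abs_sub_sub_fderiv_le_sq 0 x
  have linear : |fderiv ℝ F 0 x| ≤ ‖fderiv ℝ F 0‖ * (1 + ‖x‖ ^ 2) :=
    (fderiv ℝ F 0).le_opNorm_of_le (by nlinarith [sq_nonneg (‖x‖ - 1)])
  have triangle := abs_add_three (F 0) (fderiv ℝ F 0 x) (F x - F 0 - fderiv ℝ F 0 x)
  rw [show F 0 + fderiv ℝ F 0 x + (F x - F 0 - fderiv ℝ F 0 x) = F x by ring] at triangle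
  linarith

variable {Ω : Type*} [MeasurableSpace Ω] {P : Measure Ω} [IsFiniteMeasure P] {Y : Ω → E}

lemma integrable_norm_fderiv_sq (hF : HasHolderGradient F 1 A) (hY : MemLp Y 2 P) :
    Integrable (fun ω => ‖fderiv ℝ F (Y ω)‖ ^ 2) P :=
  ((integrable_const _).add ((hY.integrable_norm_pow two_ne_zero).const_mul _)).mono'
    ((hF.continuous_fderiv.norm.pow 2).comp_aestronglyMeasurable hY.1)
    (Eventually.of_forall fun ω => by simpa using hF.norm_fderiv_sq_le (Y ω))

lemma integrable_comp (hF : HasHolderGradient F 1 A) (hY : MemLp Y 2 P) :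
    Integrable (fun ω => F (Y ω)) P :=
  ((integrable_const _).add ((hY.integrable_norm_pow two_ne_zero).const_mul _)).mono'
    (hF.1.continuous.comp_aestronglyMeasurable hY.1)
    (Eventually.of_forall fun ω => hF.abs_le (Y ω))

end HasHolderGradient

end LipschitzGradient

section BiasedGradientDescent

variable {E S : Type*} [NormedAddCommGroup E] [InnerProductSpace ℝ E] [MeasurableSpace E]
  [MeasurableSpace S]

/-- A stochastic gradient oracle `G x s` for `F`, with noise `s` of law `γ`. Its mean need not be
the gradient of `F`: it only has to correlate with it, up to the error `c`. -/
structure IsBiasedGradientOracle (γ : Measure S) (F : E → ℝ) (G : E → S → E) (β c a b : ℝ) :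
    Prop where
  measurable : Measurable (Function.uncurry G)
  memLp_two : ∀ x, MemLp (G x) 2 γ
  le_integral_fderiv : ∀ x, β * ‖fderiv ℝ F x‖ ^ 2 - c ≤ ∫ s, fderiv ℝ F x (G x s) ∂γ
  integral_norm_sq_le : ∀ x, ∫ s, ‖G x s‖ ^ 2 ∂γ ≤ a * ‖fderiv ℝ F x‖ ^ 2 + b

namespace IsBiasedGradientOracle

variable {γ : Measure S} {F : E → ℝ} {G : E → S → E} {A β c a b h : ℝ}

lemma integral_step_le [IsProbabilityMeasure γ] (hG : IsBiasedGradientOracle γ F G β c a b)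
    (hF : HasHolderGradient F 1 A) (hA : 0 ≤ A) (hh : 0 ≤ h) (x : E) :
    ∫ s, F (x - h • G x s) ∂γ ≤
      F x - h * (β - A * h * a / 2) * ‖fderiv ℝ F x‖ ^ 2 + h * (c + A * h * b / 2) := by
  have integrable_step : Integrable (fun s => F (x - h • G x s)) γ :=
    hF.integrable_comp ((memLp_const x).sub ((hG.memLp_two x).const_smul h))
  have integrable_slope : Integrable (fun s => h * fderiv ℝ F x (G x s)) γ :=
    ((fderiv ℝ F x).integrable_comp ((hG.memLp_two x).integrable one_le_two)).const_mul h
  have integrable_sq : Integrable (fun s => A * h ^ 2 / 2 * ‖G x s‖ ^ 2) γ :=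
    ((hG.memLp_two x).integrable_norm_pow two_ne_zero).const_mul _
  have taylor (s : S) : F (x - h • G x s) ≤
      F x - h * fderiv ℝ F x (G x s) + A * h ^ 2 / 2 * ‖G x s‖ ^ 2 := by
    have remainder := (abs_le.1 (hF.abs_sub_sub_fderiv_le_sq x (-(h • G x s)))).2
    rw [map_neg, map_smul, norm_neg, norm_smul, mul_pow, Real.norm_eq_abs, sq_abs,
      smul_eq_mul, ← sub_eq_add_neg] at remainder
    linarith
  calc ∫ s, F (x - h • G x s) ∂γ
      ≤ ∫ s, (F x - h * fderiv ℝ F x (G x s) + A * h ^ 2 / 2 * ‖G x s‖ ^ 2) ∂γ :=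
        integral_mono integrable_step
          (((integrable_const _).sub integrable_slope).add integrable_sq) taylor
    _ = F x - h * ∫ s, fderiv ℝ F x (G x s) ∂γ + A * h ^ 2 / 2 * ∫ s, ‖G x s‖ ^ 2 ∂γ := by
        rw [integral_add (by exact (integrable_const _).sub integrable_slope) integrable_sq,
          integral_sub (integrable_const _) integrable_slope, integral_const_mul,
          integral_const_mul]
        simp
    _ ≤ F x - h * (β * ‖fderiv ℝ F x‖ ^ 2 - c) +
          A * h ^ 2 / 2 * (a * ‖fderiv ℝ F x‖ ^ 2 + b) := by
        gcongr
        exacts [hG.le_integral_fderiv x, hG.integral_norm_sq_le x]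
    _ = F x - h * (β - A * h * a / 2) * ‖fderiv ℝ F x‖ ^ 2 + h * (c + A * h * b / 2) := by ring

variable [BorelSpace E] [SecondCountableTopology E]

lemma measurable_step (hG : IsBiasedGradientOracle γ F G β c a b) (h : ℝ) :
    Measurable (Function.uncurry fun x s => x - h • G x s) :=
  measurable_fst.sub (hG.measurable.const_smul h)

variable {Ω : Type*} [MeasurableSpace Ω] {P : Measure Ω} [IsProbabilityMeasure P]
  [IsProbabilityMeasure γ] {x₀ : E} {U : ℕ → Ω → S} {X : ℕ → Ω → E}

lemma memLp_two_iterate (hG : IsBiasedGradientOracle γ F G β c a b)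
    (hF : HasHolderGradient F 1 A)
    (hX : IsRandomIteration γ (fun x s => x - h • G x s) x₀ P U X) (k : ℕ) :
    MemLp (X k) 2 P := by
  induction k with
  | zero => simpa only [funext hX.zero] using memLp_const x₀
  | succ k ih =>
    have law := hX.hasLaw_prodMk (hG.measurable_step h) k
    have memLp_oracle : MemLp (fun ω => G (X k ω) (U k ω)) 2 P := by
      refine (memLp_two_iff_integrable_sq_norm
        (hG.measurable.comp_aemeasurable law.aemeasurable).aestronglyMeasurable).2 ?_
      exact integrable_comp_prodMk_of_integral_le (φ := fun x s => ‖G x s‖ ^ 2)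
        (hX.aemeasurable (hG.measurable_step h) k) law (hG.measurable.norm.pow_const 2)
        (fun _ _ => sq_nonneg _)
        (fun x => (hG.memLp_two x).integrable_norm_pow two_ne_zero) hG.integral_norm_sq_le
        (((hF.continuous_fderiv.norm.pow 2).measurable.const_mul a).add_const b)
        (((hF.integrable_norm_fderiv_sq ih).const_mul a).add (integrable_const b))
    rw [funext (hX.succ k)]
    exact ih.sub (memLp_oracle.const_smul h)

lemma integral_iterate_succ_le (hG : IsBiasedGradientOracle γ F G β c a b)
    (hF : HasHolderGradient F 1 A) (hA : 0 ≤ A) (hh : 0 ≤ h)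
    (hX : IsRandomIteration γ (fun x s => x - h • G x s) x₀ P U X) (k : ℕ) :
    ∫ ω, F (X (k + 1) ω) ∂P ≤ ∫ ω, F (X k ω) ∂P -
      h * (β - A * h * a / 2) * ∫ ω, ‖fderiv ℝ F (X k ω)‖ ^ 2 ∂P + h * (c + A * h * b / 2) := by
  have integrable_value (j : ℕ) : Integrable (fun ω => F (X j ω)) P :=
    hF.integrable_comp (hG.memLp_two_iterate hF hX j)
  have integrable_gradient :
      Integrable (fun ω => h * (β - A * h * a / 2) * ‖fderiv ℝ F (X k ω)‖ ^ 2) P :=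
    (hF.integrable_norm_fderiv_sq (hG.memLp_two_iterate hF hX k)).const_mul _
  have integrable_decrease := (integrable_value k).sub integrable_gradient
  have integrable_succ := integrable_value (k + 1)
  simp_rw [hX.succ] at integrable_succ ⊢
  calc ∫ ω, F (X k ω - h • G (X k ω) (U k ω)) ∂P
      ≤ ∫ ω, (F (X k ω) - h * (β - A * h * a / 2) * ‖fderiv ℝ F (X k ω)‖ ^ 2 +
          h * (c + A * h * b / 2)) ∂P :=
        integral_comp_prodMk_le (φ := fun x s => F (x - h • G x s))
          (ψ := fun x => F x - h * (β - A * h * a / 2) * ‖fderiv ℝ F x‖ ^ 2 +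
            h * (c + A * h * b / 2))
          (hX.aemeasurable (hG.measurable_step h) k) (hX.hasLaw_prodMk (hG.measurable_step h) k)
          (hF.1.continuous.measurable.comp (hG.measurable_step h))
          ((hF.1.continuous.sub ((hF.continuous_fderiv.norm.pow 2).const_mul _)).add
            continuous_const).measurable
          integrable_succ (integrable_decrease.add (integrable_const _))
          (hG.integral_step_le hF hA hh)
    _ = ∫ ω, F (X k ω) ∂P - h * (β - A * h * a / 2) * ∫ ω, ‖fderiv ℝ F (X k ω)‖ ^ 2 ∂P +
          h * (c + A * h * b / 2) := by
        rw [integral_add (by exact integrable_decrease) (integrable_const _),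
          integral_sub (integrable_value k) integrable_gradient, integral_const_mul]
        simp

lemma sum_integral_norm_fderiv_sq_le (hG : IsBiasedGradientOracle γ F G β c a b)
    (hF : HasHolderGradient F 1 A) (hA : 0 ≤ A) (hh : 0 ≤ h)
    (hX : IsRandomIteration γ (fun x s => x - h • G x s) x₀ P U X) {m : ℝ} (hm : ∀ x, m ≤ F x)
    (N : ℕ) :
    h * (β - A * h * a / 2) * ∑ k ∈ Finset.range N, ∫ ω, ‖fderiv ℝ F (X k ω)‖ ^ 2 ∂P ≤
      F x₀ - m + N * (h * (c + A * h * b / 2)) := by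
  have telescope : h * (β - A * h * a / 2) *
      ∑ k ∈ Finset.range N, ∫ ω, ‖fderiv ℝ F (X k ω)‖ ^ 2 ∂P ≤
      F x₀ - ∫ ω, F (X N ω) ∂P + N * (h * (c + A * h * b / 2)) := by
    induction N with
    | zero => simp [hX.zero]
    | succ N ih =>
      rw [Finset.sum_range_succ, mul_add, Nat.cast_succ]
      linarith [hG.integral_iterate_succ_le hF hA hh hX N]
  have lower_bound : m ≤ ∫ ω, F (X N ω) ∂P := by
    simpa using integral_mono (μ := P) (integrable_const m)
      (hF.integrable_comp (hG.memLp_two_iterate hF hX N)) fun ω => hm (X N ω)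
  linarith

end IsBiasedGradientOracle

end BiasedGradientDescent

lemma IsInexactOracle.expGrowth {V : Type*} [NormedAddCommGroup V] [MeasurableSpace V]
    {f ft : V → ℝ} {δ : ℝ} (hft : IsInexactOracle f ft δ) (hf : ExpGrowth f) : ExpGrowth ft := by
  have noise : ExpGrowth fun z => f z - ft z :=
    (ExpGrowth.const δ).mono fun z => (hft.2.2 z).trans (le_abs_self δ)
  simpa only [sub_sub_cancel] using hf.sub noise

section FiniteDifference

variable {E : Type*} [NormedAddCommGroup E] [InnerProductSpace ℝ E]

/-- The difference quotient of `ft` between `x` and `x + μ u`, that is, the scalar factor of the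
gradient estimation `gradEst ft μ x u`. -/
def oracleSlope (ft : E → ℝ) (μ : ℝ) (x u : E) : ℝ := (ft (x + μ • u) - ft x) / μ

variable {f ft : E → ℝ} {ν L μ δ : ℝ}

lemma HasHolderGradient.abs_oracleSlope_sub_fderiv_le (hf : HasHolderGradient f ν L) (hν : 0 ≤ ν)
    (hL : 0 ≤ L) (hμ : 0 < μ) (x u : E) :
    |oracleSlope f μ x u - fderiv ℝ f x u| ≤ L * μ ^ ν * ‖u‖ ^ (1 + ν) := by
  have taylor := hf.abs_sub_sub_fderiv_le hν x (x + μ • u)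
  rw [add_sub_cancel_left, map_smul, smul_eq_mul, norm_smul_rpow hμ.le] at taylor
  have difference : oracleSlope f μ x u - fderiv ℝ f x u =
      (f (x + μ • u) - f x - μ * fderiv ℝ f x u) / μ := by
    rw [oracleSlope]
    field_simp
  rw [difference, abs_div, abs_of_pos hμ, div_le_iff₀ hμ]
  calc |f (x + μ • u) - f x - μ * fderiv ℝ f x u|
      ≤ L / (1 + ν) * (μ ^ (1 + ν) * ‖u‖ ^ (1 + ν)) := taylor
    _ ≤ L * (μ ^ (1 + ν) * ‖u‖ ^ (1 + ν)) := by
        gcongr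
        exact div_le_self hL (by linarith)
    _ = L * μ ^ ν * ‖u‖ ^ (1 + ν) * μ := by
        rw [add_comm 1 ν, Real.rpow_add_one hμ.ne']
        ring

lemma ExpGrowth.oracleSlope (hft : ExpGrowth ft) (μ : ℝ) (x : E) :
    ExpGrowth (oracleSlope ft μ x) :=
  (((hft.comp_affine x μ).sub (.const (ft x))).mul (.const μ⁻¹)).mono fun u => by
    rw [ZerothOrder.oracleSlope, div_eq_mul_inv]

variable [MeasurableSpace E]

namespace IsInexactOracle

lemma abs_oracleSlope_sub_le (hft : IsInexactOracle f ft δ) (hμ : 0 < μ) (x u : E) :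
    |oracleSlope ft μ x u - oracleSlope f μ x u| ≤ 2 * (δ / μ) := by
  have noise : |(f x - ft x) - (f (x + μ • u) - ft (x + μ • u))| ≤ 2 * δ := by
    linarith [abs_sub (f x - ft x) (f (x + μ • u) - ft (x + μ • u)), hft.2.2 x,
      hft.2.2 (x + μ • u)]
  rw [oracleSlope, oracleSlope, ← sub_div, abs_div, abs_of_pos hμ, ← mul_div_assoc]
  gcongr
  exact (congrArg abs (by ring)).trans_le noise

lemma oracleSlope_sq_le (hft : IsInexactOracle f ft δ) (hf : HasHolderGradient f ν L)
    (hν : 0 ≤ ν) (hL : 0 ≤ L) (hμ : 0 < μ) (x u : E) :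
    oracleSlope ft μ x u ^ 2 ≤
      3 * (fderiv ℝ f x u ^ 2 + (L * μ ^ ν * ‖u‖ ^ (1 + ν)) ^ 2 + (2 * (δ / μ)) ^ 2) := by
  have smooth_error := sq_le_sq' (abs_le.1 (hf.abs_oracleSlope_sub_fderiv_le hν hL hμ x u)).1
    (abs_le.1 (hf.abs_oracleSlope_sub_fderiv_le hν hL hμ x u)).2
  have noise_error := sq_le_sq' (abs_le.1 (hft.abs_oracleSlope_sub_le hμ x u)).1
    (abs_le.1 (hft.abs_oracleSlope_sub_le hμ x u)).2
  set r := oracleSlope f μ x u - fderiv ℝ f x u with hr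
  set e := oracleSlope ft μ x u - oracleSlope f μ x u with he
  rw [show oracleSlope ft μ x u = fderiv ℝ f x u + r + e by rw [hr, he]; ring]
  nlinarith [sq_nonneg (fderiv ℝ f x u - r), sq_nonneg (fderiv ℝ f x u - e), sq_nonneg (r - e)]

end IsInexactOracle

variable [BorelSpace E] [SecondCountableTopology E]

lemma measurable_oracleSlope (hm : Measurable ft) (μ : ℝ) :
    Measurable (Function.uncurry (oracleSlope ft μ)) :=
  ((hm.comp (by fun_prop)).sub (hm.comp measurable_fst)).div_const μ

end FiniteDifference

section GaussianOracle

variable {E : Type*} [NormedAddCommGroup E] [InnerProductSpace ℝ E] [FiniteDimensional ℝ E]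
  [MeasurableSpace E] [BorelSpace E]

lemma integral_strongDual_sq (T : StrongDual ℝ E) : ∫ u, T u ^ 2 ∂(stdGaussian E) = ‖T‖ ^ 2 := by
  obtain ⟨a, rfl⟩ := (InnerProductSpace.toDual ℝ E).surjective T
  simpa using integral_inner_sq a

lemma integrable_norm_sq_pow_mul_strongDual_sq (k : ℕ) (T : StrongDual ℝ E) :
    Integrable (fun u => (‖u‖ ^ 2) ^ k * T u ^ 2) (stdGaussian E) := by
  obtain ⟨a, rfl⟩ := (InnerProductSpace.toDual ℝ E).surjective T
  simpa using integrable_norm_sq_pow_mul_inner_sq k a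

lemma integral_norm_sq_mul_strongDual_sq (T : StrongDual ℝ E) :
    ∫ u, ‖u‖ ^ 2 * T u ^ 2 ∂(stdGaussian E) = (Module.finrank ℝ E + 2) * ‖T‖ ^ 2 := by
  obtain ⟨a, rfl⟩ := (InnerProductSpace.toDual ℝ E).surjective T
  simpa using integral_norm_sq_mul_inner_sq a

lemma integral_norm_sq_pow_two_mul_norm_rpow_le {ν : ℝ} (hν₀ : 0 ≤ ν) (hν₁ : ν ≤ 1) :
    ∫ u : E, (‖u‖ ^ 2) ^ 2 * ‖u‖ ^ (2 * ν) ∂(stdGaussian E) ≤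
      (Module.finrank ℝ E + 4 : ℝ) ^ ν * (Module.finrank ℝ E * (Module.finrank ℝ E + 2)) := by
  refine (integral_norm_sq_pow_mul_norm_rpow_le 2 (by positivity) (by linarith)).trans_eq ?_
  rw [integral_norm_sq_pow_two, mul_div_cancel_left₀ ν two_ne_zero]
  norm_num

variable {f ft : E → ℝ} {ν L μ δ : ℝ}

lemma integral_oracleSlope_smul_innerSL (hf : ExpGrowth f) (hm : Measurable f) (hμ : μ ≠ 0)
    (x : E) :
    ∫ u, oracleSlope f μ x u • innerSL ℝ u ∂(stdGaussian E) = fderiv ℝ (smoothed f μ) x := by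
  rw [(hasFDerivAt_smoothed_of_measurable hf hm hμ x).fderiv,
    ← integral_smul_innerSL_sub_const (hf.comp_affine x μ) (hm.comp (by fun_prop)) (f x),
    ← integral_smul]
  simp only [oracleSlope, div_eq_inv_mul, mul_smul]

lemma integrable_oracleSlope_mul_strongDual (hf : ExpGrowth f) (hm : Measurable f) (μ : ℝ) (x : E)
    (T : StrongDual ℝ E) : Integrable (fun u => oracleSlope f μ x u * T u) (stdGaussian E) :=
  ((hf.oracleSlope μ x).mul (.continuousLinearMap T)).integrable
    (((measurable_oracleSlope hm μ).of_uncurry_left).mul (by fun_prop)).aestronglyMeasurable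

lemma memLp_two_oracleSlope_smul (hf : ExpGrowth f) (hm : Measurable f) (μ : ℝ) (x : E) :
    MemLp (fun u => oracleSlope f μ x u • u) 2 (stdGaussian E) := by
  have meas : Measurable fun u => oracleSlope f μ x u • u :=
    ((measurable_oracleSlope hm μ).of_uncurry_left).smul measurable_id
  have growth : ExpGrowth fun u => oracleSlope f μ x u • u :=
    (hf.oracleSlope μ x).smul (.continuousLinearMap (ContinuousLinearMap.id ℝ E))
  refine (memLp_two_iff_integrable_sq_norm meas.aestronglyMeasurable).2 ?_
  simpa only [sq] using
    (growth.norm.mul growth.norm).integrable (meas.norm.mul meas.norm).aestronglyMeasurable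

lemma integral_oracleSlope_mul_fderiv_smoothed (hf : ExpGrowth f) (hm : Measurable f) (hμ : μ ≠ 0)
    (x : E) :
    ∫ u, oracleSlope f μ x u * fderiv ℝ (smoothed f μ) x u ∂(stdGaussian E) =
      ‖fderiv ℝ (smoothed f μ) x‖ ^ 2 := by
  have mean := integral_oracleSlope_smul_innerSL hf hm hμ x
  obtain ⟨a, ha⟩ := (InnerProductSpace.toDual ℝ E).surjective (fderiv ℝ (smoothed f μ) x)
  have integrable_smul : Integrable (fun u => oracleSlope f μ x u • innerSL ℝ u) (stdGaussian E) :=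
    ((hf.oracleSlope μ x).smul (.continuousLinearMap (innerSL ℝ))).integrable
      (((measurable_oracleSlope hm μ).of_uncurry_left).smul (by fun_prop)).aestronglyMeasurable
  have mean_apply := congrArg (fun T : StrongDual ℝ E => T a) mean
  rw [ContinuousLinearMap.integral_apply integrable_smul] at mean_apply
  rw [← ha] at mean_apply ⊢
  simpa [real_inner_comm a] using mean_apply

namespace IsInexactOracle

lemma integral_norm_oracleSlope_smul_sq_le (hft : IsInexactOracle f ft δ)
    (hf : HasHolderGradient f ν L) (hν₀ : 0 ≤ ν) (hν₁ : ν ≤ 1) (hL : 0 ≤ L) (hμ : 0 < μ) (x : E) :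
    ∫ u, ‖oracleSlope ft μ x u • u‖ ^ 2 ∂(stdGaussian E) ≤
      3 * ((Module.finrank ℝ E + 2) * ‖fderiv ℝ f x‖ ^ 2 +
        (L * μ ^ ν) ^ 2 * ((Module.finrank ℝ E + 4 : ℝ) ^ ν *
          (Module.finrank ℝ E * (Module.finrank ℝ E + 2))) +
        4 * (δ / μ) ^ 2 * Module.finrank ℝ E) := by
  have integrable_gradient :
      Integrable (fun u => ‖u‖ ^ 2 * fderiv ℝ f x u ^ 2) (stdGaussian E) := by
    simpa using integrable_norm_sq_pow_mul_strongDual_sq 1 (fderiv ℝ f x)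
  have integrable_smooth : Integrable
      (fun u : E => (L * μ ^ ν) ^ 2 * ((‖u‖ ^ 2) ^ 2 * ‖u‖ ^ (2 * ν))) (stdGaussian E) :=
    (((ExpGrowth.norm_sq_pow 2).mul (.norm_rpow (by positivity : 0 ≤ 2 * ν))).integrable
      (by fun_prop)).const_mul _
  have integrable_noise : Integrable (fun u : E => 4 * (δ / μ) ^ 2 * ‖u‖ ^ 2) (stdGaussian E) := by
    simpa using (integrable_norm_sq_pow (E := E) 1).const_mul (4 * (δ / μ) ^ 2)
  have pointwise (u : E) : ‖oracleSlope ft μ x u • u‖ ^ 2 ≤ 3 * (‖u‖ ^ 2 * fderiv ℝ f x u ^ 2 +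
      (L * μ ^ ν) ^ 2 * ((‖u‖ ^ 2) ^ 2 * ‖u‖ ^ (2 * ν)) + 4 * (δ / μ) ^ 2 * ‖u‖ ^ 2) := by
    rw [norm_smul, mul_pow, Real.norm_eq_abs, sq_abs]
    refine (mul_le_mul_of_nonneg_right (hft.oracleSlope_sq_le hf hν₀ hL hμ x u)
      (sq_nonneg ‖u‖)).trans_eq ?_
    rw [add_comm 1 ν, Real.rpow_add_one' (norm_nonneg u) (by positivity), mul_comm 2 ν,
      Real.rpow_mul (norm_nonneg u), Real.rpow_two]
    ring
  calc ∫ u, ‖oracleSlope ft μ x u • u‖ ^ 2 ∂(stdGaussian E)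
      ≤ ∫ u, 3 * (‖u‖ ^ 2 * fderiv ℝ f x u ^ 2 +
          (L * μ ^ ν) ^ 2 * ((‖u‖ ^ 2) ^ 2 * ‖u‖ ^ (2 * ν)) +
          4 * (δ / μ) ^ 2 * ‖u‖ ^ 2) ∂(stdGaussian E) :=
        integral_mono ((memLp_two_oracleSlope_smul (hft.expGrowth (hf.expGrowth hν₀)) hft.2.1 μ
          x).integrable_norm_pow two_ne_zero)
          (((integrable_gradient.add integrable_smooth).add integrable_noise).const_mul 3) pointwise
    _ = 3 * ((Module.finrank ℝ E + 2) * ‖fderiv ℝ f x‖ ^ 2 +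
          (L * μ ^ ν) ^ 2 * ∫ u : E, (‖u‖ ^ 2) ^ 2 * ‖u‖ ^ (2 * ν) ∂(stdGaussian E) +
          4 * (δ / μ) ^ 2 * Module.finrank ℝ E) := by
        rw [integral_const_mul, integral_add (by exact integrable_gradient.add integrable_smooth)
          integrable_noise, integral_add integrable_gradient integrable_smooth, integral_const_mul,
          integral_const_mul, integral_norm_sq, integral_norm_sq_mul_strongDual_sq]
    _ ≤ _ := by
        gcongr
        exact integral_norm_sq_pow_two_mul_norm_rpow_le hν₀ hν₁

lemma le_integral_oracleSlope_mul_fderiv_smoothed (hft : IsInexactOracle f ft δ) (hf : ExpGrowth f)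
    (hm : Measurable f) (hμ : 0 < μ) (x : E) :
    3 / 4 * ‖fderiv ℝ (smoothed f μ) x‖ ^ 2 - 4 * (δ / μ) ^ 2 ≤
      ∫ u, oracleSlope ft μ x u * fderiv ℝ (smoothed f μ) x u ∂(stdGaussian E) := by
  set g := fderiv ℝ (smoothed f μ) x with hg
  have integrable_exact := integrable_oracleSlope_mul_strongDual hf hm μ x g
  have integrable_sq : Integrable (fun u => g u ^ 2 / 4) (stdGaussian E) := by
    simpa using (integrable_norm_sq_pow_mul_strongDual_sq 0 g).div_const 4
  have pointwise (u : E) : oracleSlope f μ x u * g u - g u ^ 2 / 4 - 4 * (δ / μ) ^ 2 ≤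
      oracleSlope ft μ x u * g u := by
    have noise := sq_le_sq' (abs_le.1 (hft.abs_oracleSlope_sub_le hμ x u)).1
      (abs_le.1 (hft.abs_oracleSlope_sub_le hμ x u)).2
    nlinarith [sq_nonneg (g u / 2 + (oracleSlope ft μ x u - oracleSlope f μ x u))]
  calc 3 / 4 * ‖g‖ ^ 2 - 4 * (δ / μ) ^ 2
      = ∫ u, (oracleSlope f μ x u * g u - g u ^ 2 / 4 - 4 * (δ / μ) ^ 2) ∂(stdGaussian E) := by
        rw [integral_sub (by exact integrable_exact.sub integrable_sq) (integrable_const _),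
          integral_sub integrable_exact integrable_sq,
          integral_oracleSlope_mul_fderiv_smoothed hf hm hμ.ne', ← hg, integral_div,
          integral_strongDual_sq]
        simp
        ring
    _ ≤ ∫ u, oracleSlope ft μ x u * g u ∂(stdGaussian E) :=
        integral_mono ((integrable_exact.sub integrable_sq).sub (integrable_const _))
          (integrable_oracleSlope_mul_strongDual (hft.expGrowth hf) hft.2.1 μ x g) pointwise

lemma isBiasedGradientOracle (hft : IsInexactOracle f ft δ) (hf : HasHolderGradient f ν L)
    (hν₀ : 0 ≤ ν) (hν₁ : ν ≤ 1) (hL : 0 ≤ L) (hμ : 0 < μ) :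
    IsBiasedGradientOracle (stdGaussian E) (smoothed f μ) (fun x u => oracleSlope ft μ x u • u)
      (3 / 4) (4 * (δ / μ) ^ 2) (6 * (Module.finrank ℝ E + 2))
      (3 * (Module.finrank ℝ E + 2) ^ 2 * (L * μ ^ ν) ^ 2 * (Module.finrank ℝ E + 4 : ℝ) ^ ν +
        12 * Module.finrank ℝ E * (δ / μ) ^ 2) where
  measurable := (measurable_oracleSlope hft.2.1 μ).smul measurable_snd
  memLp_two := memLp_two_oracleSlope_smul (hft.expGrowth (hf.expGrowth hν₀)) hft.2.1 μ
  le_integral_fderiv x := by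
    simpa only [map_smul, smul_eq_mul] using hft.le_integral_oracleSlope_mul_fderiv_smoothed
      (hf.expGrowth hν₀) hf.1.continuous.measurable hμ x
  integral_norm_sq_le x := by
    refine (hft.integral_norm_oracleSlope_smul_sq_le hf hν₀ hν₁ hL hμ x).trans ?_
    have gradient_sq : ‖fderiv ℝ f x‖ ^ 2 ≤ 2 * (‖fderiv ℝ (smoothed f μ) x‖ ^ 2 +
        (L * μ ^ ν) ^ 2 * (Module.finrank ℝ E + 4 : ℝ) ^ ν) := by
      have gradient_le := (norm_le_norm_add_norm_sub (fderiv ℝ (smoothed f μ) x)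
        (fderiv ℝ f x)).trans (add_le_add_right
          (hf.norm_fderiv_smoothed_sub_le hν₀ hν₁ hL hμ.le x) _)
      refine (pow_le_pow_left₀ (norm_nonneg _) gradient_le 2).trans (add_sq_le.trans ?_)
      rw [mul_pow, ← Real.rpow_mul_natCast (by positivity), Nat.cast_ofNat,
        div_mul_cancel₀ ν two_ne_zero]
      gcongr
      linarith
    calc _ ≤ 3 * ((Module.finrank ℝ E + 2) * (2 * (‖fderiv ℝ (smoothed f μ) x‖ ^ 2 +
          (L * μ ^ ν) ^ 2 * (Module.finrank ℝ E + 4 : ℝ) ^ ν)) +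
        (L * μ ^ ν) ^ 2 * ((Module.finrank ℝ E + 4 : ℝ) ^ ν *
          (Module.finrank ℝ E * (Module.finrank ℝ E + 2))) +
        4 * (δ / μ) ^ 2 * Module.finrank ℝ E) := by gcongr
      _ = _ := by ring

end IsInexactOracle

end GaussianOracle

lemma isRandomIteration_iterate {E Ω : Type*} [NormedAddCommGroup E]
    [InnerProductSpace ℝ E] [FiniteDimensional ℝ E] [MeasurableSpace E] [MeasurableSpace Ω]
    {P : Measure Ω} {U : ℕ → Ω → E}
    (law : ∀ k, HasLaw (U k) (stdGaussian E) P) (indep : iIndepFun U P) (ft : E → ℝ) (μ h : ℝ)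
    (x₀ : E) :
    IsRandomIteration (stdGaussian E) (fun x u => x - h • (oracleSlope ft μ x u • u)) x₀ P U
      (fun k ω => iterate ft μ (fun _ => h) x₀ (fun j => U j ω) k) where
  hasLaw := law
  iIndepFun := indep
  zero _ := rfl
  succ k ω := by
    rw [iterate, gradEst, map_smul, LinearIsometryEquiv.symm_apply_apply, oracleSlope]

section Constants

variable {ν L μ δ : ℝ} {n : ℕ}

lemma smoothConst_pos (hL : 0 < L) (hn : 1 ≤ n) (hμ : 0 < μ) : 0 < smoothConst ν L n μ := by
  unfold smoothConst
  positivity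

lemma stepSize_pos (hL : 0 < L) (hn : 1 ≤ n) (hμ : 0 < μ) : 0 < stepSize ν L n μ := by
  have := smoothConst_pos (ν := ν) hL hn hμ
  unfold stepSize
  positivity

lemma smoothConst_mul_stepSize (hL : 0 < L) (hn : 1 ≤ n) (hμ : 0 < μ) :
    smoothConst ν L n μ * stepSize ν L n μ = μ ^ (1 - ν) / (80 * ((n : ℝ) + 4)) := by
  have := smoothConst_pos (ν := ν) hL hn hμ
  rw [stepSize]
  field_simp

lemma div_sq_le_of_le_noiseBound (hν₁ : ν ≤ 1) (hn : 1 ≤ n) (hμ : 0 < μ) (hμ₁ : μ ≤ 1)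
    (hδ : 0 ≤ δ) (hδn : δ ≤ noiseBound ν n μ) : (δ / μ) ^ 2 ≤ μ ^ (1 + ν) := by
  have noise_le : δ / μ ≤ μ ^ ((3 - ν) / 2) := by
    rw [div_le_iff₀ hμ, ← Real.rpow_add_one hμ.ne']
    refine hδn.trans ((div_le_self (by positivity)
      (Real.one_le_rpow (by exact_mod_cast hn) (by linarith))).trans_eq ?_)
    ring_nf
  calc (δ / μ) ^ 2 ≤ (μ ^ ((3 - ν) / 2)) ^ 2 := by gcongr
    _ = μ ^ (3 - ν) := by
      rw [← Real.rpow_mul_natCast hμ.le, Nat.cast_ofNat, div_mul_cancel₀ _ two_ne_zero]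
    _ ≤ μ ^ (1 + ν) := Real.rpow_le_rpow_of_exponent_ge hμ hμ₁ (by linarith)

lemma add_four_rpow_le (hν₀ : 0 ≤ ν) (hν₁ : ν ≤ 1) (hn : 1 ≤ n) :
    (n + 4 : ℝ) ^ (1 + ν) ≤ 25 * (n : ℝ) ^ (1 + ν) := by
  have one_le : (1 : ℝ) ≤ n := by exact_mod_cast hn
  calc (n + 4 : ℝ) ^ (1 + ν) ≤ (5 * n : ℝ) ^ (1 + ν) := by
        gcongr
        linarith
    _ = 5 ^ (1 + ν) * (n : ℝ) ^ (1 + ν) := Real.mul_rpow (by positivity) (by positivity)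
    _ ≤ 5 ^ (2 : ℝ) * (n : ℝ) ^ (1 + ν) := by
        gcongr
        · norm_num
        · linarith
    _ = 25 * (n : ℝ) ^ (1 + ν) := by norm_num

lemma rpow_mul_smoothing_error_le (hν₀ : 0 ≤ ν) (hν₁ : ν ≤ 1) (hn : 1 ≤ n) (hμ : 0 < μ) :
    μ ^ (1 - ν) / (n + 4) * ((n + 2) ^ 2 * (L * μ ^ ν) ^ 2 * (n + 4 : ℝ) ^ ν) ≤
      25 * L ^ 2 * (μ * n) ^ (1 + ν) := by
  have power : μ ^ (1 - ν) * (μ ^ ν) ^ 2 = μ ^ (1 + ν) := by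
    rw [← Real.rpow_mul_natCast hμ.le, ← Real.rpow_add hμ]
    congr 1
    push_cast
    ring
  calc μ ^ (1 - ν) / (n + 4) * ((n + 2) ^ 2 * (L * μ ^ ν) ^ 2 * (n + 4 : ℝ) ^ ν)
      ≤ μ ^ (1 - ν) / (n + 4) * ((n + 4) ^ 2 * (L * μ ^ ν) ^ 2 * (n + 4 : ℝ) ^ ν) := by
        gcongr
        norm_num
    _ = L ^ 2 * (μ ^ (1 - ν) * (μ ^ ν) ^ 2) * ((n + 4 : ℝ) ^ ν * (n + 4)) := by
        field_simp
    _ = L ^ 2 * μ ^ (1 + ν) * (n + 4 : ℝ) ^ (1 + ν) := by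
        rw [power, add_comm 1 ν, ← Real.rpow_add_one (by positivity)]
    _ ≤ L ^ 2 * μ ^ (1 + ν) * (25 * (n : ℝ) ^ (1 + ν)) := by
        gcongr
        exact add_four_rpow_le hν₀ hν₁ hn
    _ = 25 * L ^ 2 * (μ * n) ^ (1 + ν) := by
        rw [Real.mul_rpow hμ.le (by positivity)]
        ring

lemma one_half_le_decrease_factor (hν₁ : ν ≤ 1) (hL : 0 < L) (hn : 1 ≤ n) (hμ : 0 < μ)
    (hμ₁ : μ ≤ 1) :
    1 / 2 ≤ 3 / 4 - smoothConst ν L n μ * stepSize ν L n μ * (6 * (n + 2)) / 2 := by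
  have step_le : μ ^ (1 - ν) / (80 * ((n : ℝ) + 4)) ≤ 1 / (80 * ((n : ℝ) + 4)) := by
    gcongr
    exact Real.rpow_le_one hμ.le hμ₁ (by linarith)
  have ratio_le : 1 / (80 * ((n : ℝ) + 4)) * (6 * (n + 2)) ≤ 1 / 2 := by
    rw [one_div_mul_eq_div, div_le_div_iff₀ (by positivity) two_pos]
    linarith [(Nat.cast_nonneg n : (0 : ℝ) ≤ n)]
  rw [smoothConst_mul_stepSize hL hn hμ]
  linarith [mul_le_mul_of_nonneg_right step_le (by positivity : (0 : ℝ) ≤ 6 * (n + 2))]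

lemma step_error_le (hν₀ : 0 ≤ ν) (hν₁ : ν ≤ 1) (hL : 0 < L) (hn : 1 ≤ n) (hμ : 0 < μ)
    (hμ₁ : μ ≤ 1) (hδ : 0 ≤ δ) (hδn : δ ≤ noiseBound ν n μ) :
    4 * (δ / μ) ^ 2 + smoothConst ν L n μ * stepSize ν L n μ *
      (3 * (n + 2) ^ 2 * (L * μ ^ ν) ^ 2 * (n + 4 : ℝ) ^ ν + 12 * n * (δ / μ) ^ 2) / 2 ≤
      (5 + L ^ 2) * (μ * n) ^ (1 + ν) := by
  have one_le : (1 : ℝ) ≤ n := by exact_mod_cast hn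
  have noise_sq_le : (δ / μ) ^ 2 ≤ (μ * n) ^ (1 + ν) :=
    (div_sq_le_of_le_noiseBound hν₁ hn hμ hμ₁ hδ hδn).trans
      (Real.rpow_le_rpow hμ.le (le_mul_of_one_le_right hμ.le one_le) (by positivity))
  have step_le : μ ^ (1 - ν) / (n + 4) * n ≤ 1 := by
    rw [div_mul_eq_mul_div, div_le_one (by positivity)]
    nlinarith [Real.rpow_le_one hμ.le hμ₁ (by linarith : 0 ≤ 1 - ν)]
  have smoothing := rpow_mul_smoothing_error_le (L := L) hν₀ hν₁ hn hμ
  rw [smoothConst_mul_stepSize hL hn hμ]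
  calc 4 * (δ / μ) ^ 2 + μ ^ (1 - ν) / (80 * (n + 4)) *
        (3 * (n + 2) ^ 2 * (L * μ ^ ν) ^ 2 * (n + 4 : ℝ) ^ ν + 12 * n * (δ / μ) ^ 2) / 2
      = 4 * (δ / μ) ^ 2 + 3 / 160 * (μ ^ (1 - ν) / (n + 4) *
          ((n + 2) ^ 2 * (L * μ ^ ν) ^ 2 * (n + 4 : ℝ) ^ ν)) +
          3 / 40 * (μ ^ (1 - ν) / (n + 4) * n) * (δ / μ) ^ 2 := by
        field_simp
        ring
    _ ≤ 4 * (μ * n) ^ (1 + ν) + 3 / 160 * (25 * L ^ 2 * (μ * n) ^ (1 + ν)) +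
          3 / 40 * 1 * (μ * n) ^ (1 + ν) := by gcongr
    _ ≤ (5 + L ^ 2) * (μ * n) ^ (1 + ν) := by
        have : 0 ≤ (μ * n) ^ (1 + ν) := by positivity
        nlinarith [mul_nonneg (sq_nonneg L) this]

lemma le_stepSize (hL : 0 < L) (hn : 1 ≤ n) (hμ : 0 < μ) :
    μ ^ (2 * (1 - ν)) / (400 * L * (n * (n : ℝ) ^ ((1 + ν) / 2))) ≤ stepSize ν L n μ := by
  have one_le : (1 : ℝ) ≤ n := by exact_mod_cast hn
  have square : μ ^ (2 * (1 - ν)) = μ ^ (1 - ν) * μ ^ (1 - ν) := by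
    rw [two_mul, Real.rpow_add hμ]
  calc μ ^ (2 * (1 - ν)) / (400 * L * (n * (n : ℝ) ^ ((1 + ν) / 2)))
      = μ ^ (2 * (1 - ν)) / (80 * (5 * n) * (L * (n : ℝ) ^ ((1 + ν) / 2))) := by ring_nf
    _ ≤ μ ^ (2 * (1 - ν)) / (80 * (n + 4) * (L * (n : ℝ) ^ ((1 + ν) / 2))) := by
        gcongr
        linarith
    _ = stepSize ν L n μ := by
        rw [stepSize, smoothConst, square]
        field_simp

end Constants

section SmoothingParameter

/-- The smoothing parameter `μ` for which `(μ n)^(1+ν) = K`. In the theorem `K` is a fixed multiple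
of the accuracy `ε`. -/
def smoothingParam (ν : ℝ) (n : ℕ) (K : ℝ) : ℝ := K ^ (1 / (1 + ν)) / n

/-- The ratio `K / ε` for which the error of a step of the method is at most `ε / 4`, while the
smoothing parameter stays below `1` for all `ε ≤ εmax`. -/
def accuracyFactor (L εmax : ℝ) : ℝ := 1 / (4 * (5 + L ^ 2) * (1 + εmax))

variable {ν L K a ε εmax : ℝ} {n : ℕ}

lemma smoothingParam_pos (hn : 1 ≤ n) (hK : 0 < K) : 0 < smoothingParam ν n K := by
  unfold smoothingParam
  positivity

lemma smoothingParam_lt_one (hν : 0 ≤ ν) (hn : 1 ≤ n) (hK : 0 < K) (hK₁ : K < 1) :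
    smoothingParam ν n K < 1 :=
  (div_le_self (by positivity) (by exact_mod_cast hn)).trans_lt
    (Real.rpow_lt_one hK.le hK₁ (by positivity))

lemma smoothingParam_mul_rpow (hν : 0 ≤ ν) (hn : 1 ≤ n) (hK : 0 < K) :
    (smoothingParam ν n K * n) ^ (1 + ν) = K := by
  rw [smoothingParam, div_mul_cancel₀ _ (by positivity), ← Real.rpow_mul hK.le,
    one_div_mul_cancel (by positivity), Real.rpow_one]

lemma smoothingParam_rpow (hK : 0 < K) (t : ℝ) :
    smoothingParam ν n K ^ t = K ^ (t / (1 + ν)) / (n : ℝ) ^ t := by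
  rw [smoothingParam, Real.div_rpow (by positivity) (by positivity), ← Real.rpow_mul hK.le,
    one_div_mul_eq_div]

lemma gapBound_smoothingParam (hν : 0 ≤ ν) (hn : 1 ≤ n) (hK : 0 < K) :
    gapBound ν L n (smoothingParam ν n K) = L / (1 + ν) * (K / (n : ℝ) ^ ((1 + ν) / 2)) := by
  have n_pos : (0 : ℝ) < n := by exact_mod_cast hn
  have square : (n : ℝ) ^ (1 + ν) = (n : ℝ) ^ ((1 + ν) / 2) * (n : ℝ) ^ ((1 + ν) / 2) := by
    rw [← Real.rpow_add n_pos, add_halves]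
  rw [gapBound, smoothingParam_rpow hK, div_self (by positivity), Real.rpow_one, square]
  have := Real.rpow_pos_of_pos n_pos ((1 + ν) / 2)
  field_simp

lemma gapBound_smoothingParam_le (hν : 0 ≤ ν) (hL : 0 ≤ L) (hn : 1 ≤ n) (hK : 0 < K)
    (hK₁ : K ≤ 1) : gapBound ν L n (smoothingParam ν n K) ≤ L := by
  rw [gapBound_smoothingParam hν hn hK]
  have ratio_le : K / (n : ℝ) ^ ((1 + ν) / 2) ≤ 1 :=
    (div_le_self hK.le (Real.one_le_rpow (by exact_mod_cast hn) (by positivity))).trans hK₁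
  calc L / (1 + ν) * (K / (n : ℝ) ^ ((1 + ν) / 2)) ≤ L * 1 := by
        gcongr
        exact div_le_self hL (by linarith)
    _ = L := mul_one L

lemma noiseBound_smoothingParam_mul (hn : 1 ≤ n) (ha : 0 < a) (hε : 0 < ε) :
    noiseBound ν n (smoothingParam ν n (a * ε)) = a ^ ((5 - ν) / (2 * (1 + ν))) *
      (ε ^ ((5 - ν) / (2 * (1 + ν))) / (n : ℝ) ^ ((13 - 3 * ν) / 4)) := by
  have n_pos : (0 : ℝ) < n := by exact_mod_cast hn
  rw [noiseBound, smoothingParam_rpow (mul_pos ha hε), div_div, div_div, ← Real.rpow_add n_pos,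
    Real.mul_rpow ha.le hε.le, mul_div_assoc]
  ring_nf

lemma le_stepSize_smoothingParam (hL : 0 < L) (hn : 1 ≤ n) (hK : 0 < K) :
    K ^ (2 * (1 - ν) / (1 + ν)) / (400 * L * (n : ℝ) ^ ((7 - 3 * ν) / 2)) ≤
      stepSize ν L n (smoothingParam ν n K) := by
  have n_pos : (0 : ℝ) < n := by exact_mod_cast hn
  have exponents : (n : ℝ) ^ ((7 - 3 * ν) / 2) =
      (n : ℝ) ^ (2 * (1 - ν)) * (n * (n : ℝ) ^ ((1 + ν) / 2)) := by
    rw [← mul_assoc, ← Real.rpow_add_one n_pos.ne', ← Real.rpow_add n_pos]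
    ring_nf
  refine Eq.trans_le ?_ (le_stepSize hL hn (smoothingParam_pos hn hK))
  rw [smoothingParam_rpow hK, exponents]
  field_simp

/-- The constant hidden in the iteration count, for the smoothing parameter with `K = a ε`. -/
def iterationConst (ν L Δ a : ℝ) : ℝ := 1600 * L * (Δ + L) / a ^ (2 * (1 - ν) / (1 + ν))

lemma iterationConst_pos (ν : ℝ) {Δ : ℝ} (hL : 0 < L) (hΔ : 0 ≤ Δ) (ha : 0 < a) :
    0 < iterationConst ν L Δ a := by
  unfold iterationConst
  positivity

lemma le_mul_stepSize_smoothingParam {Δ N : ℝ} (hν : 0 ≤ ν) (hL : 0 < L) (hn : 1 ≤ n)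
    (ha : 0 < a) (hε : 0 < ε)
    (hN : iterationConst ν L Δ a * ((n : ℝ) ^ ((7 - 3 * ν) / 2) / ε ^ ((3 - ν) / (1 + ν))) ≤ N)
    (hN₀ : 0 ≤ N) : Δ + L ≤ N * (stepSize ν L n (smoothingParam ν n (a * ε)) * (ε / 4)) := by
  have step_ge := le_stepSize_smoothingParam (ν := ν) hL hn (mul_pos ha hε)
  set p := 2 * (1 - ν) / (1 + ν) with hp
  have exponents : ε ^ ((3 - ν) / (1 + ν)) = ε ^ p * ε := by
    rw [← Real.rpow_add_one hε.ne', hp]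
    congr 1
    field_simp
    ring
  have := Real.rpow_pos_of_pos ha p
  have := Real.rpow_pos_of_pos hε p
  rw [iterationConst, exponents] at hN
  rw [Real.mul_rpow ha.le hε.le] at step_ge
  calc Δ + L = 1600 * L * (Δ + L) / a ^ p * ((n : ℝ) ^ ((7 - 3 * ν) / 2) / (ε ^ p * ε)) *
        (a ^ p * ε ^ p / (400 * L * (n : ℝ) ^ ((7 - 3 * ν) / 2)) * (ε / 4)) := by
        field_simp
        ring
    _ ≤ _ := by gcongr

lemma accuracyFactor_pos (L : ℝ) (hεmax : 0 < εmax) : 0 < accuracyFactor L εmax := by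
  unfold accuracyFactor
  positivity

lemma mul_accuracyFactor_mul_le (L : ℝ) (hε : 0 ≤ ε) (hεmax : 0 ≤ εmax) :
    (5 + L ^ 2) * (accuracyFactor L εmax * ε) ≤ ε / 4 :=
  calc (5 + L ^ 2) * (accuracyFactor L εmax * ε) = ε / 4 / (1 + εmax) := by
        rw [accuracyFactor]
        field_simp
    _ ≤ ε / 4 := div_le_self (by positivity) (by linarith)

lemma accuracyFactor_mul_lt_one (L : ℝ) (hε : 0 ≤ ε) (hεm : ε ≤ εmax) :
    accuracyFactor L εmax * ε < 1 := by
  have εmax_nonneg : 0 ≤ εmax := hε.trans hεm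
  rw [accuracyFactor, one_div_mul_eq_div, div_lt_one (by positivity)]
  nlinarith [mul_nonneg (sq_nonneg L) εmax_nonneg, sq_nonneg L]

end SmoothingParameter

section Convergence

variable {E Ω : Type*} [NormedAddCommGroup E] [InnerProductSpace ℝ E] [FiniteDimensional ℝ E]
  [MeasurableSpace E] [BorelSpace E] [MeasurableSpace Ω] {P : Measure Ω} [IsProbabilityMeasure P]
  {f ft : E → ℝ} {ν L μ δ m : ℝ} {x₀ : E} {U : ℕ → Ω → E} {X : ℕ → Ω → E}

lemma HasHolderGradient.le_smoothed (hf : HasHolderGradient f ν L) (hν : 0 ≤ ν)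
    (hm : ∀ x, m ≤ f x) (x : E) : m ≤ ZerothOrder.smoothed f μ x := by
  rw [smoothed_eq_integral]
  simpa using integral_mono (μ := stdGaussian E) (integrable_const m)
    (hf.integrable_comp_affine hν x μ) fun u => hm (x + μ • u)

namespace IsInexactOracle

lemma sum_integral_norm_fderiv_smoothed_sq_le (hft : IsInexactOracle f ft δ)
    (hf : HasHolderGradient f ν L) (hν₀ : 0 ≤ ν) (hν₁ : ν ≤ 1) (hL : 0 < L)
    (hn : 1 ≤ Module.finrank ℝ E) (hμ : 0 < μ) (hμ₁ : μ ≤ 1)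
    (hδ : δ ≤ noiseBound ν (Module.finrank ℝ E) μ) (hm : ∀ x, m ≤ f x)
    (hX : IsRandomIteration (stdGaussian E) (fun x u =>
      x - stepSize ν L (Module.finrank ℝ E) μ • (oracleSlope ft μ x u • u)) x₀ P U X) (N : ℕ) :
    stepSize ν L (Module.finrank ℝ E) μ * (1 / 2) *
        ∑ k ∈ Finset.range N, ∫ ω, ‖fderiv ℝ (smoothed f μ) (X k ω)‖ ^ 2 ∂P ≤
      f x₀ - m + gapBound ν L (Module.finrank ℝ E) μ + N * (stepSize ν L (Module.finrank ℝ E) μ *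
        ((5 + L ^ 2) * (μ * Module.finrank ℝ E) ^ (1 + ν))) := by
  have step_pos := stepSize_pos (ν := ν) hL hn hμ
  have descent := (hft.isBiasedGradientOracle hf hν₀ hν₁ hL.le hμ).sum_integral_norm_fderiv_sq_le
    (hf.smoothed hν₀ hν₁ hL.le hμ) (smoothConst_pos hL hn hμ).le step_pos.le hX
    (hf.le_smoothed hν₀ hm) N
  have gap := (abs_le.1 (hf.abs_smoothed_sub_le_gapBound hν₀ hν₁ hL.le hμ.le x₀)).2
  have : 0 ≤ ∑ k ∈ Finset.range N, ∫ ω, ‖fderiv ℝ (smoothed f μ) (X k ω)‖ ^ 2 ∂P :=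
    Finset.sum_nonneg fun k _ => integral_nonneg fun ω => sq_nonneg _
  calc stepSize ν L (Module.finrank ℝ E) μ * (1 / 2) *
        ∑ k ∈ Finset.range N, ∫ ω, ‖fderiv ℝ (smoothed f μ) (X k ω)‖ ^ 2 ∂P
      ≤ _ := by
        gcongr
        exact one_half_le_decrease_factor hν₁ hL hn hμ hμ₁
    _ ≤ _ := descent
    _ ≤ _ := by
        gcongr ?_ + N * (_ * ?_)
        · linarith
        · exact step_error_le hν₀ hν₁ hL hn hμ hμ₁ hft.1.le hδ

lemma integrable_norm_fderiv_smoothed_sq (hft : IsInexactOracle f ft δ)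
    (hf : HasHolderGradient f ν L) (hν₀ : 0 ≤ ν) (hν₁ : ν ≤ 1) (hL : 0 ≤ L) (hμ : 0 < μ) {h : ℝ}
    (hX : IsRandomIteration (stdGaussian E) (fun x u => x - h • (oracleSlope ft μ x u • u))
      x₀ P U X) (k : ℕ) :
    Integrable (fun ω => ‖fderiv ℝ (smoothed f μ) (X k ω)‖ ^ 2) P :=
  have holder := hf.smoothed hν₀ hν₁ hL hμ
  holder.integrable_norm_fderiv_sq
    ((hft.isBiasedGradientOracle hf hν₀ hν₁ hL hμ).memLp_two_iterate holder hX k)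

lemma exists_integral_norm_fderiv_smoothed_sq_le (hft : IsInexactOracle f ft δ)
    (hf : HasHolderGradient f ν L) (hν₀ : 0 ≤ ν) (hν₁ : ν ≤ 1) (hL : 0 < L)
    (hn : 1 ≤ Module.finrank ℝ E) (hμ : 0 < μ) (hμ₁ : μ ≤ 1)
    (hδ : δ ≤ noiseBound ν (Module.finrank ℝ E) μ) (hm : ∀ x, m ≤ f x)
    (hX : IsRandomIteration (stdGaussian E) (fun x u =>
      x - stepSize ν L (Module.finrank ℝ E) μ • (oracleSlope ft μ x u • u)) x₀ P U X)
    {ε : ℝ} (hε : (5 + L ^ 2) * (μ * Module.finrank ℝ E) ^ (1 + ν) ≤ ε / 4) {N : ℕ} (hN₀ : 0 < N)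
    (hN : f x₀ - m + gapBound ν L (Module.finrank ℝ E) μ ≤
      N * (stepSize ν L (Module.finrank ℝ E) μ * (ε / 4))) :
    ∃ k < N, ∫ ω, ‖fderiv ℝ (smoothed f μ) (X k ω)‖ ^ 2 ∂P ≤ ε := by
  have step_pos := stepSize_pos (ν := ν) hL hn hμ
  have descent := hft.sum_integral_norm_fderiv_smoothed_sq_le hf hν₀ hν₁ hL hn hμ hμ₁ hδ hm hX N
  set h := stepSize ν L (Module.finrank ℝ E) μ
  have error_le : N * (h * ((5 + L ^ 2) * (μ * Module.finrank ℝ E) ^ (1 + ν))) ≤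
      N * (h * (ε / 4)) := by gcongr
  have sum_le : ∑ k ∈ Finset.range N, ∫ ω, ‖fderiv ℝ (smoothed f μ) (X k ω)‖ ^ 2 ∂P ≤ N * ε := by
    refine le_of_mul_le_mul_left ?_ (by positivity : 0 < h * (1 / 2))
    linarith
  obtain ⟨k, hk, le⟩ := Finset.exists_le_of_sum_le (Finset.nonempty_range_iff.2 hN₀.ne')
    (sum_le.trans_eq (by simp : N * ε = ∑ _k ∈ Finset.range N, ε))
  exact ⟨k, Finset.mem_range.1 hk, le⟩

lemma exists_integral_norm_fderiv_smoothingParam_sq_le {Δ ε εmax : ℝ}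
    (hft : IsInexactOracle f ft δ) (hf : HasHolderGradient f ν L) (hν₀ : 0 ≤ ν) (hν₁ : ν ≤ 1)
    (hL : 0 < L) (hn : 1 ≤ Module.finrank ℝ E) (hΔ : 0 ≤ Δ) (hε : 0 < ε) (hε_le : ε ≤ εmax)
    (hμ : μ = smoothingParam ν (Module.finrank ℝ E) (accuracyFactor L εmax * ε))
    (hδ : δ ≤ noiseBound ν (Module.finrank ℝ E) μ) (hm : ∀ x, m ≤ f x) (hx₀ : f x₀ - m ≤ Δ)
    (hX : IsRandomIteration (stdGaussian E) (fun x u =>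
      x - stepSize ν L (Module.finrank ℝ E) μ • (oracleSlope ft μ x u • u)) x₀ P U X) {N : ℕ}
    (hN : iterationConst ν L Δ (accuracyFactor L εmax) *
      ((Module.finrank ℝ E : ℝ) ^ ((7 - 3 * ν) / 2) / ε ^ ((3 - ν) / (1 + ν))) ≤ N) :
    ∃ k < N, ∫ ω, ‖fderiv ℝ (smoothed f μ) (X k ω)‖ ^ 2 ∂P ≤ ε := by
  have εmax_pos : 0 < εmax := hε.trans_le hε_le
  have a_pos := accuracyFactor_pos L εmax_pos
  have K_pos := mul_pos a_pos hε
  have K_lt_one := accuracyFactor_mul_lt_one L hε.le hε_le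
  have cN_pos := iterationConst_pos ν hL hΔ a_pos
  have N_pos : (0 : ℝ) < N := lt_of_lt_of_le (by positivity) hN
  subst hμ
  refine hft.exists_integral_norm_fderiv_smoothed_sq_le hf hν₀ hν₁ hL hn
    (smoothingParam_pos hn K_pos) (smoothingParam_lt_one hν₀ hn K_pos K_lt_one).le hδ hm hX ?_
    (by exact_mod_cast N_pos) ?_
  · rw [smoothingParam_mul_rpow hν₀ hn K_pos]
    exact mul_accuracyFactor_mul_le L hε.le εmax_pos.le
  · exact (add_le_add hx₀ (gapBound_smoothingParam_le hν₀ hL.le hn K_pos K_lt_one.le)).trans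
      (le_mul_stepSize_smoothingParam hν₀ hL hn a_pos hε hN N_pos.le)

end IsInexactOracle

end Convergence

end ZerothOrder

end

open ZerothOrder

theorem theorem2 (ν L Δ εmax : ℝ) (hν₀ : 0 ≤ ν) (hν₁ : ν ≤ 1) (hL : 0 < L) (hΔ : 0 ≤ Δ)
    (hεmax : 0 < εmax) :
    -- The constants hidden in the asymptotic notation depend on `ν`, `L`, `Δ` and `εmax` only.
    ∃ cN cδ c₁ c₂ : ℝ, 0 < cN ∧ 0 < cδ ∧ 0 < c₁ ∧ 0 < c₂ ∧
      ∀ n : ℕ, 1 ≤ n → ∀ ε : ℝ, 0 < ε → ε ≤ εmax →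
      -- The smoothing parameter depends on the target accuracy and the dimension, not on `f`.
      ∃ μ : ℝ, 0 < μ ∧ μ < 1 ∧
        c₁ * (ε / (n : ℝ) ^ ((1 + ν) / 2)) ≤ ZerothOrder.gapBound ν L n μ ∧
        ZerothOrder.gapBound ν L n μ ≤ c₂ * (ε / (n : ℝ) ^ ((1 + ν) / 2)) ∧
        ZerothOrder.noiseBound ν n μ ≤
          cδ * (ε ^ ((5 - ν) / (2 * (1 + ν))) / (n : ℝ) ^ ((13 - 3 * ν) / 4)) ∧
        ∀ (E : Type u) [NormedAddCommGroup E] [InnerProductSpace ℝ E] [FiniteDimensional ℝ E]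
          [MeasurableSpace E] [BorelSpace E], Module.finrank ℝ E = n →
        ∀ f : E → ℝ, ZerothOrder.HasHolderGradient f ν L → BddBelow (Set.range f) →
          -- The smoothed function is well defined and differentiable, and uniformly close to `f`.
          (∀ x : E, Integrable (fun w : E => f (x + μ • w) * Real.exp (-(1 / 2) * ‖w‖ ^ 2))) ∧
          Differentiable ℝ (ZerothOrder.smoothed f μ) ∧
          (∀ x : E, |ZerothOrder.smoothed f μ x - f x| ≤ ZerothOrder.gapBound ν L n μ) ∧
          -- Convergence of the process with an inexact oracle.
          ∀ (δ : ℝ) (ft : E → ℝ), ZerothOrder.IsInexactOracle f ft δ →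
            δ < ZerothOrder.noiseBound ν n μ →
          ∀ x₀ : E, f x₀ - ⨅ x : E, f x ≤ Δ →
          ∀ (Ω : Type v) [MeasurableSpace Ω] (P : Measure Ω) [IsProbabilityMeasure P]
            (U : ℕ → Ω → E), (∀ k, HasLaw (U k) (stdGaussian E) P) → iIndepFun U P →
          (∀ k : ℕ, Integrable (fun ω => ‖fderiv ℝ (ZerothOrder.smoothed f μ)
            (ZerothOrder.iterate ft μ (fun _ => ZerothOrder.stepSize ν L n μ) x₀
              (fun j => U j ω) k)‖ ^ 2) P) ∧
          ∀ N : ℕ, cN * ((n : ℝ) ^ ((7 - 3 * ν) / 2) / ε ^ ((3 - ν) / (1 + ν))) ≤ N →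
            ∃ k < N, ∫ ω, ‖fderiv ℝ (ZerothOrder.smoothed f μ)
              (ZerothOrder.iterate ft μ (fun _ => ZerothOrder.stepSize ν L n μ) x₀
                (fun j => U j ω) k)‖ ^ 2 ∂P ≤ ε := by
  set a := accuracyFactor L εmax
  have a_pos : 0 < a := accuracyFactor_pos L hεmax
  refine ⟨iterationConst ν L Δ a, a ^ ((5 - ν) / (2 * (1 + ν))), L / (1 + ν) * a,
    L / (1 + ν) * a, iterationConst_pos ν hL hΔ a_pos, by positivity, by positivity,
    by positivity, fun n hn ε hε hε_le => ?_⟩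
  have K_pos : 0 < a * ε := mul_pos a_pos hε
  have gap_eq : gapBound ν L n (smoothingParam ν n (a * ε)) =
      L / (1 + ν) * a * (ε / (n : ℝ) ^ ((1 + ν) / 2)) := by
    rw [gapBound_smoothingParam hν₀ hn K_pos, mul_div_assoc, mul_assoc]
  have μ_pos := smoothingParam_pos (ν := ν) hn K_pos
  refine ⟨smoothingParam ν n (a * ε), μ_pos, smoothingParam_lt_one hν₀ hn K_pos
    (accuracyFactor_mul_lt_one L hε.le hε_le), gap_eq.ge, gap_eq.le,
    (noiseBound_smoothingParam_mul hn a_pos hε).le, ?_⟩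
  rintro E _ _ _ _ _ rfl f hf hbdd
  refine ⟨hf.integrable_mul_exp hν₀ _, hf.differentiable_smoothed hν₀ _,
    hf.abs_smoothed_sub_le_gapBound hν₀ hν₁ hL.le μ_pos.le, ?_⟩
  intro δ ft hft hδ x₀ hx₀ Ω _ P _ U law indep
  have hX := isRandomIteration_iterate law indep ft
  exact ⟨hft.integrable_norm_fderiv_smoothed_sq hf hν₀ hν₁ hL.le μ_pos (hX _ _ x₀), fun N hN =>
    hft.exists_integral_norm_fderiv_smoothingParam_sq_le hf hν₀ hν₁ hL hn hΔ hε hε_le rfl hδ.le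
      (fun x => ciInf_le hbdd x) hx₀ (hX _ _ x₀) hN⟩
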